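/- Let $\lambda_t\ge 2$ ($t\ge 0$) be integers, $n_0=1$, $n_{t+1}=\lambda_t n_t$, and let $(X,T,m_X)$ be the odometer: $X=\varprojlim \mathbb Z/n_t\mathbb Z$ (equivalently $\prod_t\mathbb Z/\lambda_t\mathbb Z$ with addition with carry), $Tx=x+1$, $m_X$ the normalized Haar measure. Let $\overline T$ be a uniquely ergodic homeomorphism of a compact metric space $\overline X$ with invariant probability measure $\overline{m_X}$, and let $\pi\colon\overline X\to X$ be a topological factor map (continuous, onto, $\pi\overline T=T\pi$); assume that $(\overline T,\overline{m_X})$ and $(T,m_X)$ are measure-theoretically isomorphic. Let $G$ be a compact metric group with normalized Haar measure $m_G$, let $\psi\colon X\to G$ be measurable, $T_\psi(x,g)=(Tx,\psi(x)g)$ on $(X\times G,m_X\otimes m_G)$, and assume that $T_\psi$ is ergodic. Assume that $\psi\circ\pi$ has a continuous version, i.e. that there is a continuous $\overline\psi\colon\overline X\to G$ with $\overline\psi=\psi\circ\pi$ $\overline{m_X}$-a.e.; let $\overline T_{\overline\psi}(\overline x,g)=(\overline T\,\overline x,\overline\psi(\overline x)g)$ on $\overline X\times G$. Let $r\ne s$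 be integers such that $(T_\psi)^r$ and $(T_\psi)^s$ are ergodic. For a measure-theoretic isomorphism $R$ from $(X,m_X,T^r)$ to $(X,m_X,T^s)$ let $(m_X)_R$ be the graph joining, $(m_X)_R(B\times C)=m_X(B\cap R^{-1}C)$. For a joining $\rho$ of the bases of two extensions, $\widetilde\rho$ denotes its relatively independent extension: if $\mu_x$, $\nu_y$ are the disintegrations of the measures of the two extensions over their bases, then $\widetilde\rho=\int \mu_x\otimes\nu_y\,d\rho(x,y)$, i.e. $\int F\otimes H\,d\widetilde\rho=\int \mathbb E(F|X)(x)\,\mathbb E(H|Y)(y)\,d\rho(x,y)$. Here the extensions are $X\times G\to X$ and $\overline X\times G\to\overline X$ with the product measures. A point $z$ is generic for $\mu$ under $S$ if $\frac1N\sum_{n=1}^N\delta_{S^nz}\to\mu$ weakly. Assume that every ergodic joining of $(T_\psi)^r$ and $(T_\psi)^s$ is of the form $\widetilde{(m_X)_R}$ for some isomorphism $R$ from $T^r$ to $T^s$. Let $\overline x\in\overline X$. Then there is an isomorphism $R$ from $T^r$ to $T^s$ such that $(\pi(\overline x),\pi(\overline x))$ is generic for $(m_X)_R$ under $T^r\times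 T^s$. Moreover, for every such $R$, there is a unique $\overline T^r\times\overline T^s$-invariant Borel probability measure $\overline\rho$ on $\overline X\times\overline X$ for which every point of $(\pi\times\pi)^{-1}(\pi(\overline x),\pi(\overline x))$ is generic, and 1. for each $g\in G$, the point $((\overline x,g),(\overline x,g))$ is generic for $\widetilde{\overline\rho}$ under $(\overline T_{\overline\psi})^r\times(\overline T_{\overline\psi})^s$; 2. the systems $\big((\overline T_{\overline\psi})^r\times(\overline T_{\overline\psi})^s,\widetilde{\overline\rho}\big)$ and $\big((T_\psi)^r\times(T_\psi)^s,\widetilde{(m_X)_R}\big)$ are measure-theoretically isomorphic. -/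

import Mathlib

open MeasureTheory ProbabilityTheory Filter Topology

/-- The numbers `n_t = λ_0 λ_1 ⋯ λ_{t-1}`, so that `n_0 = 1` and `n_{t+1} / n_t = λ_t`. -/
def odometerScale (lam : ℕ → ℕ) (t : ℕ) : ℕ := ∏ i ∈ Finset.range t, lam i

theorem odometerScale_dvd_succ (lam : ℕ → ℕ) (t : ℕ) :
    odometerScale lam t ∣ odometerScale lam (t + 1) :=
  ⟨lam t, by simp [odometerScale, Finset.prod_range_succ]⟩

/-- The coherent sequences in `∏ₜ ℤ/n_tℤ`, i.e. the inverse limit of the rings `ℤ/n_tℤ`. -/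
def odometerSubring (lam : ℕ → ℕ) : Subring (∀ t, ZMod (odometerScale lam t)) where
  carrier := {x | ∀ t, ZMod.castHom (odometerScale_dvd_succ lam t)
    (ZMod (odometerScale lam t)) (x (t + 1)) = x t}
  zero_mem' := fun t => by simp only [Pi.zero_apply, map_zero]
  one_mem' := fun t => by simp only [Pi.one_apply, map_one]
  add_mem' := fun {x y} hx hy t => by
    simp only [Pi.add_apply, map_add]; rw [hx t, hy t]
  mul_mem' := fun {x y} hx hy t => by
    simp only [Pi.mul_apply, map_mul]; rw [hx t, hy t]
  neg_mem' := fun {x} hx t => by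
    simp only [Pi.neg_apply, map_neg]; rw [hx t]

/-- The phase space of the odometer with quotients `λ_t = n_{t+1} / n_t`: the compact abelian group
`lim ℤ/n_tℤ` (for `λ_t ≥ 1`).  The expansion
`(x_0, x_1, …) ↦ (x_0 + x_1 n_1 + ⋯ + x_{t-1} n_{t-1} mod n_t)ₜ` identifies
`∏ₜ ℤ/λ_tℤ`, with addition with carry to the right, with this group. -/
def Odometer (lam : ℕ → ℕ) : Type := odometerSubring lam

namespace Odometer

variable (lam : ℕ → ℕ)

instance : CommRing (Odometer lam) := inferInstanceAs (CommRing (odometerSubring lam))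

/-- The subspace topology of the product topology, each `ℤ/n_tℤ` being discrete. -/
instance : TopologicalSpace (Odometer lam) :=
  inferInstanceAs (TopologicalSpace (odometerSubring lam))

instance : MeasurableSpace (Odometer lam) := borel _

instance : BorelSpace (Odometer lam) := ⟨rfl⟩

instance : PolishSpace (Odometer lam) := by
  have (t : ℕ) : Countable (ZMod (odometerScale lam t)) := by
    cases odometerScale lam t with
    | zero => exact inferInstanceAs (Countable ℤ)
    | succ n => exact inferInstanceAs (Countable (Fin (n + 1)))
  have hc : IsClosed ((odometerSubring lam : Set (∀ t, ZMod (odometerScale lam t)))) := by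
    have : ((odometerSubring lam : Set (∀ t, ZMod (odometerScale lam t)))) =
        ⋂ t, {x | ZMod.castHom (odometerScale_dvd_succ lam t)
          (ZMod (odometerScale lam t)) (x (t + 1)) = x t} := by
      ext x; simp only [Set.mem_iInter]; rfl
    rw [this]
    exact isClosed_iInter fun t =>
      isClosed_eq (continuous_of_discreteTopology.comp (continuous_apply (t + 1)))
        (continuous_apply t)
  exact hc.polishSpace

/-- The odometer map `T x = x + 1`, where `1 = (1, 1, 1, …)` corresponds to `(1, 0, 0, …)` in the
digit expansion. -/
def shift : Equiv.Perm (Odometer lam) := Equiv.addRight 1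

end Odometer

section ErgodicTheory

/-- `R` is a measure-theoretic isomorphism of `(X, μ, T)` and `(Y, ν, S)`. -/
structure IsMeasureIso {X Y : Type*} [MeasurableSpace X] [MeasurableSpace Y]
    (μ : Measure X) (ν : Measure Y) (T : X → X) (S : Y → Y) (R : X → Y) : Prop where
  measurePreserving : MeasurePreserving R μ ν
  equivariant : R ∘ T =ᵐ[μ] S ∘ R
  invertible : ∃ R' : Y → X, MeasurePreserving R' ν μ ∧ R' ∘ R =ᵐ[μ] id ∧ R ∘ R' =ᵐ[ν] id

/-- The systems `(X, μ, T)` and `(Y, ν, S)` are measure-theoretically isomorphic. -/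
def MeasureIsomorphic {X Y : Type*} [MeasurableSpace X] [MeasurableSpace Y]
    (μ : Measure X) (ν : Measure Y) (T : X → X) (S : Y → Y) : Prop :=
  ∃ R : X → Y, IsMeasureIso μ ν T S R

/-- `μ` is a `T`-invariant probability measure, and the only one. -/
structure IsUniquelyErgodic {X : Type*} [MeasurableSpace X] (T : X → X) (μ : Measure X) :
    Prop where
  isProbabilityMeasure : IsProbabilityMeasure μ
  measurePreserving : MeasurePreserving T μ μ
  unique : ∀ ν : Measure X, IsProbabilityMeasure ν → MeasurePreserving T ν ν → ν = μ

/-- `π` is a topological factor map from `(X', T')` onto `(X, T)`. -/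
structure IsTopologicalFactor {X' X : Type*} [TopologicalSpace X'] [TopologicalSpace X]
    (T' : X' → X') (T : X → X) (π : X' → X) : Prop where
  continuous : Continuous π
  surjective : Function.Surjective π
  equivariant : π ∘ T' = T ∘ π

/-- `κ` is an ergodic joining of `(X, μ, T)` and `(Y, ν, S)`: an ergodic `T × S`-invariant measure
with projections `μ` and `ν`. -/
structure IsErgodicJoining {X Y : Type*} [MeasurableSpace X] [MeasurableSpace Y]
    (μ : Measure X) (ν : Measure Y) (T : X → X) (S : Y → Y) (κ : Measure (X × Y)) : Prop where
  map_fst : κ.map Prod.fst = μ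
  map_snd : κ.map Prod.snd = ν
  ergodic : Ergodic (Prod.map T S) κ

/-- The graph measure `μ_R`, with `μ_R (B × C) = μ (B ∩ R⁻¹ C)`. -/
noncomputable def graphJoining {X Y : Type*} [MeasurableSpace X] [MeasurableSpace Y]
    (μ : Measure X) (R : X → Y) : Measure (X × Y) :=
  μ.map fun x => (x, R x)

/-- The relatively independent extension of a joining `ρ` of two factors `π₁ : (X', μ') → X` and
`π₂ : (Y', ν') → Y`.  If `μ'_x` and `ν'_y` denote the disintegrations of `μ'` over `X` and of `ν'`
over `Y`, this is `∫ μ'_x ⊗ ν'_y dρ(x, y)`; thus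
`∫ F ⊗ H = ∫ E(F | X)(x) E(H | Y)(y) dρ(x, y)`, which for `ρ = μ_R` is
`∫ E(F | X) · (E(H | Y) ∘ R) dμ`. -/
noncomputable def relIndepExtension {X' Y' X Y : Type*}
    [MeasurableSpace X'] [StandardBorelSpace X'] [Nonempty X']
    [MeasurableSpace Y'] [StandardBorelSpace Y'] [Nonempty Y']
    [MeasurableSpace X] [MeasurableSpace Y]
    (μ' : Measure X') [IsFiniteMeasure μ'] (ν' : Measure Y') [IsFiniteMeasure ν']
    (π₁ : X' → X) (π₂ : Y' → Y) (ρ : Measure (X × Y)) : Measure (X' × Y') :=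
  ρ.bind (Kernel.parallelComp (condDistrib id π₁ μ') (condDistrib id π₂ ν'))

/-- The skew product `T_ψ (x, g) = (T x, ψ(x) g)`. -/
def skewProduct {X G : Type*} [Group G] (T : Equiv.Perm X) (ψ : X → G) :
    Equiv.Perm (X × G) where
  toFun p := (T p.1, ψ p.1 * p.2)
  invFun p := (T.symm p.1, (ψ (T.symm p.1))⁻¹ * p.2)
  left_inv p := by simp
  right_inv p := by simp

/-- The point `z` of the compact space `Z` is generic for `μ` under `T`:
`(1/N) ∑_{1 ≤ n ≤ N} δ_{Tⁿ z} → μ` weakly. -/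
def IsGeneric {Z : Type*} [TopologicalSpace Z] [MeasurableSpace Z]
    (T : Z → Z) (z : Z) (μ : Measure Z) : Prop :=
  ∀ f : C(Z, ℝ), Tendsto (fun N : ℕ => (N : ℝ)⁻¹ * ∑ n ∈ Finset.Icc 1 N, f (T^[n] z)) atTop
    (𝓝 (∫ w, f w ∂μ))

/-- `ρ'` is an invariant probability measure for which every point over `z` is generic. -/
structure IsGenericLift {Z' Z : Type*} [TopologicalSpace Z'] [MeasurableSpace Z']
    (T' : Z' → Z') (p : Z' → Z) (z : Z) (ρ' : Measure Z') : Prop where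
  isProbabilityMeasure : IsProbabilityMeasure ρ'
  measurePreserving : MeasurePreserving T' ρ' ρ'
  isGeneric : ∀ z' : Z', p z' = z → IsGeneric T' z' ρ'

end ErgodicTheory

/-!
The point `(π x, π x)` is generic for an ergodic measure under any product of rotations of
a compact abelian group, namely for the Haar measure of a coset of a closed subgroup. This
measure is a joining of `T^r` and `T^s`, the latter being uniquely ergodic. Any ergodic
joining `κ` of `T^r` and `T^s` has an ergodic lift to a joining of `(T_ψ)^r` and
`(T_ψ)^s`: lift first to the compact continuous models and take an extreme point of the
set of invariant lifts. By the hypothesis on joinings, `κ` is then a graph joining, and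
its relatively independent extension is ergodic.

Since `T̄^r` and `T̄^s` are uniquely ergodic and isomorphic to `T^r` and `T^s` through
`π`, the joining `κ` has exactly one invariant lift `ρ̄` to `X̄ × X̄`. Likewise, the
relatively independent extension of `ρ̄` is the only invariant lift of `ρ̄`: being
ergodic, it is the unique invariant measure of a compact group extension over its base
(Furstenberg). A unique lift inherits generic points from the factor, because every limit
point of the empirical measures is an invariant lift.
-/

section GenericPoints

variable {K L : Type*} [TopologicalSpace K] [MeasurableSpace K]
  [TopologicalSpace L] [MeasurableSpace L] {S : K → K} {S' : L → L} {p : K → L} {z : K}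

theorem isGeneric_iff_tendsto_birkhoffAverage {μ : Measure K} :
    IsGeneric S z μ ↔ ∀ f : C(K, ℝ),
      Tendsto (fun N => birkhoffAverage ℝ S f N (S z)) atTop (𝓝 (∫ w, f w ∂μ)) := by
  have average_eq (f : C(K, ℝ)) (N : ℕ) :
      (N : ℝ)⁻¹ * ∑ n ∈ Finset.Icc 1 N, f (S^[n] z) = birkhoffAverage ℝ S f N (S z) := by
    rw [birkhoffAverage, birkhoffSum, smul_eq_mul, ← Finset.Ico_add_one_right_eq_Icc,
      Finset.sum_Ico_eq_sum_range, Nat.add_sub_cancel]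
    simp only [add_comm 1, Function.iterate_succ_apply]
  simp only [IsGeneric, average_eq]

theorem IsGeneric.unique [BorelSpace K] [HasOuterApproxClosed K] {μ ν : Measure K}
    [IsFiniteMeasure μ] [IsFiniteMeasure ν] (hμ : IsGeneric S z μ) (hν : IsGeneric S z ν) :
    μ = ν :=
  ext_of_forall_integral_eq_of_IsFiniteMeasure fun f =>
    tendsto_nhds_unique (hμ f.toContinuousMap) (hν f.toContinuousMap)

theorem IsGeneric.map [BorelSpace K] [BorelSpace L] {μ : Measure K}
    (hz : IsGeneric S z μ) (hp : Continuous p) (hpS : Function.Semiconj p S S') :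
    IsGeneric S' (p z) (μ.map p) := fun f => by
  have hf := hz (f.comp ⟨p, hp⟩)
  simp only [ContinuousMap.comp_apply, ContinuousMap.coe_mk, (hpS.iterate_right _).eq] at hf
  rwa [integral_map_of_stronglyMeasurable hp.measurable f.continuous.stronglyMeasurable]

/-- The uniform probability measure on the orbit segment `S z, S² z, …, S^(N+1) z`; its integrals
are the averages in `IsGeneric`.  The shift by one avoids the empty segment. -/
noncomputable def empiricalMeasure (S : K → K) (z : K) (N : ℕ) : ProbabilityMeasure K :=
  ⟨((N + 1 : ℕ) : ENNReal)⁻¹ • ∑ n ∈ Finset.range (N + 1), Measure.dirac (S^[n] (S z)), ⟨by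
    simp only [Measure.smul_apply, Measure.finsetSum_apply, measure_univ, smul_eq_mul,
      Finset.sum_const, Finset.card_range, nsmul_eq_mul, mul_one]
    exact ENNReal.inv_mul_cancel (by simp) (ENNReal.natCast_ne_top _)⟩⟩

omit [TopologicalSpace K] in
theorem integral_empiricalMeasure {f : K → ℝ} (hf : StronglyMeasurable f) (N : ℕ) :
    ∫ w, f w ∂(empiricalMeasure S z N : Measure K) = birkhoffAverage ℝ S f (N + 1) (S z) := by
  rw [empiricalMeasure, ProbabilityMeasure.coe_mk, integral_smul_measure,
    integral_finsetSum_measure fun _ _ => integrable_dirac' hf (by simp)]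
  simp only [integral_dirac' _ _ hf, ENNReal.toReal_inv, ENNReal.toReal_natCast, birkhoffAverage,
    birkhoffSum]

omit [TopologicalSpace K] [TopologicalSpace L] in
theorem map_empiricalMeasure (hp : Measurable p) (hpS : Function.Semiconj p S S') (N : ℕ) :
    (empiricalMeasure S z N).map hp.aemeasurable = empiricalMeasure S' (p z) N := by
  refine ProbabilityMeasure.toMeasure_injective (Measure.ext fun A hA => ?_)
  rw [ProbabilityMeasure.toMeasure_map, Measure.map_apply hp hA]
  simp only [empiricalMeasure, ProbabilityMeasure.coe_mk, Measure.smul_apply,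
    Measure.finsetSum_apply, Measure.dirac_apply' _ hA, Measure.dirac_apply' _ (hp hA), ← hpS.eq,
    ← (hpS.iterate_right _).eq]
  rfl

theorem tendsto_empiricalMeasure_iff [BorelSpace K] [CompactSpace K] {μ : ProbabilityMeasure K} :
    Tendsto (empiricalMeasure S z) atTop (𝓝 μ) ↔ IsGeneric S z (μ : Measure K) := by
  rw [ProbabilityMeasure.tendsto_iff_forall_integral_tendsto, isGeneric_iff_tendsto_birkhoffAverage]
  have integral_tendsto_iff (f : C(K, ℝ)) :
      Tendsto (fun N => ∫ w, f w ∂(empiricalMeasure S z N : Measure K)) atTop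
        (𝓝 (∫ w, f w ∂(μ : Measure K))) ↔
      Tendsto (fun N => birkhoffAverage ℝ S f N (S z)) atTop (𝓝 (∫ w, f w ∂(μ : Measure K))) := by
    simp only [integral_empiricalMeasure f.continuous.stronglyMeasurable]
    exact tendsto_add_atTop_iff_nat (f := fun N => birkhoffAverage ℝ S f N (S z)) 1
  exact ⟨fun h f => (integral_tendsto_iff f).1 (h (BoundedContinuousFunction.mkOfCompact f)),
    fun h f => (integral_tendsto_iff f.toContinuousMap).2 (h f.toContinuousMap)⟩

theorem measurePreserving_of_mapClusterPt_empiricalMeasure [BorelSpace K] [HasOuterApproxClosed K]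
    (hS : Continuous S) {μ : ProbabilityMeasure K}
    (hμ : MapClusterPt μ atTop (empiricalMeasure S z)) :
    MeasurePreserving S (μ : Measure K) μ := by
  obtain ⟨U, hU, hμU⟩ := mapClusterPt_iff_ultrafilter.1 hμ
  have integral_tendsto (f : BoundedContinuousFunction K ℝ) :
      Tendsto (fun N => birkhoffAverage ℝ S f (N + 1) (S z)) U
        (𝓝 (∫ w, f w ∂(μ : Measure K))) := by
    simpa only [integral_empiricalMeasure f.continuous.stronglyMeasurable]
      using ProbabilityMeasure.tendsto_iff_forall_integral_tendsto.1 hμU f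
  have := Measure.isProbabilityMeasure_map (μ := (μ : Measure K)) hS.measurable.aemeasurable
  refine ⟨hS.measurable, ext_of_forall_integral_eq_of_IsFiniteMeasure fun f => ?_⟩
  rw [integral_map_of_stronglyMeasurable hS.measurable f.continuous.stronglyMeasurable,
    ← sub_eq_zero]
  -- The averages of `f ∘ S` and `f` along the orbit differ by a telescoping sum.
  have difference_tendsto : Tendsto (fun N => birkhoffAverage ℝ S f (N + 1) (S (S z)) -
      birkhoffAverage ℝ S f (N + 1) (S z)) U (𝓝 0) :=
    ((tendsto_birkhoffAverage_apply_sub_birkhoffAverage' ℝ f.isBounded_range S (S z)).comp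
      (tendsto_add_atTop_nat 1)).mono_left hU
  have average_comp (N : ℕ) : birkhoffAverage ℝ S (f.compContinuous ⟨S, hS⟩) (N + 1) (S z) =
      birkhoffAverage ℝ S f (N + 1) (S (S z)) := by
    simp only [birkhoffAverage, birkhoffSum, BoundedContinuousFunction.compContinuous_apply,
      ContinuousMap.coe_mk, ← Function.iterate_succ_apply' S, ← Function.iterate_succ_apply]
  refine tendsto_nhds_unique ((integral_tendsto (f.compContinuous ⟨S, hS⟩)).sub
    (integral_tendsto f)) ?_
  simpa only [average_comp] using difference_tendsto

theorem map_eq_of_mapClusterPt_empiricalMeasure [BorelSpace K] [BorelSpace L] [CompactSpace L]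
    [HasOuterApproxClosed L] (hp : Continuous p) (hpS : Function.Semiconj p S S')
    {β : ProbabilityMeasure L} (hβ : IsGeneric S' (p z) (β : Measure L))
    {μ : ProbabilityMeasure K} (hμ : MapClusterPt μ atTop (empiricalMeasure S z)) :
    (μ : Measure K).map p = β := by
  obtain ⟨U, hU, hμU⟩ := mapClusterPt_iff_ultrafilter.1 hμ
  have map_tendsto := ((ProbabilityMeasure.continuous_map hp).tendsto μ).comp hμU
  simp only [Function.comp_def, map_empiricalMeasure hp.measurable hpS] at map_tendsto
  exact congrArg ProbabilityMeasure.toMeasure (tendsto_nhds_unique map_tendsto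
    ((tendsto_empiricalMeasure_iff.2 hβ).mono_left hU))

/-- `m` is the only `S`-invariant probability measure which the factor map `p` carries to `β`. -/
structure IsUniqueInvariantLift (S : K → K) (p : K → L) (β : Measure L) (m : Measure K) :
    Prop where
  isProbabilityMeasure : IsProbabilityMeasure m
  measurePreserving : MeasurePreserving S m m
  map_eq : m.map p = β
  unique : ∀ μ : Measure K, IsProbabilityMeasure μ → MeasurePreserving S μ μ → μ.map p = β → μ = m

theorem IsUniqueInvariantLift.isGeneric [BorelSpace K] [CompactSpace K] [T2Space K]
    [HasOuterApproxClosed K] [BorelSpace L] [CompactSpace L] [HasOuterApproxClosed L]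
    {β : Measure L} {m : Measure K} (hm : IsUniqueInvariantLift S p β m) (hS : Continuous S)
    (hp : Continuous p) (hpS : Function.Semiconj p S S') (hβ : IsGeneric S' (p z) β) :
    IsGeneric S z m := by
  have := hm.isProbabilityMeasure
  have : IsProbabilityMeasure β :=
    hm.map_eq ▸ Measure.isProbabilityMeasure_map hp.measurable.aemeasurable
  refine (tendsto_empiricalMeasure_iff (μ := ⟨m, inferInstance⟩)).1 <|
    tendsto_nhds_of_unique_mapClusterPt fun μ hμ => ProbabilityMeasure.toMeasure_injective ?_
  exact hm.unique μ inferInstance (measurePreserving_of_mapClusterPt_empiricalMeasure hS hμ)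
    (map_eq_of_mapClusterPt_empiricalMeasure (β := ⟨β, inferInstance⟩) hp hpS hβ hμ)

theorem IsUniqueInvariantLift.isGenericLift [BorelSpace K] [CompactSpace K] [T2Space K]
    [HasOuterApproxClosed K] [BorelSpace L] [CompactSpace L] [HasOuterApproxClosed L]
    {β : Measure L} {m : Measure K} {w : L} (hm : IsUniqueInvariantLift S p β m)
    (hS : Continuous S) (hp : Continuous p) (hpS : Function.Semiconj p S S')
    (hβ : IsGeneric S' w β) : IsGenericLift S p w m :=
  ⟨hm.isProbabilityMeasure, hm.measurePreserving,
    fun _ hz => hm.isGeneric hS hp hpS (hz.symm ▸ hβ)⟩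

omit [TopologicalSpace L] [MeasurableSpace L] in
theorem IsGenericLift.unique [BorelSpace K] [HasOuterApproxClosed K] {μ ν : Measure K}
    (hμ : IsGenericLift S p (p z) μ) (hν : IsGenericLift S p (p z) ν) : μ = ν :=
  have := hμ.isProbabilityMeasure
  have := hν.isProbabilityMeasure
  (hμ.isGeneric z rfl).unique (hν.isGeneric z rfl)

theorem IsUniquelyErgodic.isGeneric [BorelSpace K] [CompactSpace K] [T2Space K]
    [HasOuterApproxClosed K] {m : Measure K} (hm : IsUniquelyErgodic S m) (hS : Continuous S)
    (z : K) : IsGeneric S z m := by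
  have := hm.isProbabilityMeasure
  refine (tendsto_empiricalMeasure_iff (μ := ⟨m, inferInstance⟩)).1 <|
    tendsto_nhds_of_unique_mapClusterPt fun μ hμ => ProbabilityMeasure.toMeasure_injective ?_
  exact hm.unique μ inferInstance (measurePreserving_of_mapClusterPt_empiricalMeasure hS hμ)

end GenericPoints

section ErgodicLifts

variable {K L : Type*} [TopologicalSpace K] [MeasurableSpace K] [BorelSpace K]
  [HasOuterApproxClosed K]

theorem exists_mem_extremePoints_of_isCompact {M : Set (ProbabilityMeasure K)} (hM : IsCompact M)
    (hne : M.Nonempty) :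
    ∃ μ ∈ M,
      (μ : Measure K) ∈ Set.extremePoints ENNReal (ProbabilityMeasure.toMeasure '' M) := by
  let Φ (μ : ProbabilityMeasure K) (f : BoundedContinuousFunction K ℝ) : ℝ :=
    ∫ w, f w ∂(μ : Measure K)
  have hΦ : Continuous Φ :=
    continuous_pi fun f => ProbabilityMeasure.continuous_integral_boundedContinuousFunction f
  obtain ⟨_, ⟨μ, hμ, rfl⟩, extreme⟩ :=
    (hM.image hΦ).extremePoints_nonempty (hne.image Φ)
  refine ⟨μ, hμ, ⟨μ, hμ, rfl⟩, ?_⟩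
  rintro _ ⟨ν₁, hν₁, rfl⟩ _ ⟨ν₂, hν₂, rfl⟩ ⟨a, b, ha, hb, hab, hμab⟩
  have ha_top : a ≠ ⊤ := ne_top_of_le_ne_top ENNReal.one_ne_top (hab ▸ le_self_add)
  have hb_top : b ≠ ⊤ := ne_top_of_le_ne_top ENNReal.one_ne_top (hab ▸ le_add_self)
  have hΦab : a.toReal • Φ ν₁ + b.toReal • Φ ν₂ = Φ μ := by
    ext f
    simp only [Φ, ← hμab, Pi.add_apply, Pi.smul_apply, ← integral_smul_measure]
    exact (integral_add_measure ((f.integrable _).smul_measure ha_top)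
      ((f.integrable _).smul_measure hb_top)).symm
  have hΦ_eq : Φ ν₁ = Φ μ := extreme ⟨ν₁, hν₁, rfl⟩ ⟨ν₂, hν₂, rfl⟩
    ⟨a.toReal, b.toReal, ENNReal.toReal_pos ha.ne' ha_top, ENNReal.toReal_pos hb.ne' hb_top,
      by rw [← ENNReal.toReal_add ha_top hb_top, hab, ENNReal.toReal_one], hΦab⟩
  exact ext_of_forall_integral_eq_of_IsFiniteMeasure (congrFun hΦ_eq)

variable [TopologicalSpace L] [MeasurableSpace L] [BorelSpace L] [HasOuterApproxClosed L]
  {S : K → K} {S' : L → L} {p : K → L}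

theorem isClosed_setOf_invariant_lift (hS : Continuous S) (hp : Continuous p) (β : Measure L)
    [IsProbabilityMeasure β] :
    IsClosed {μ : ProbabilityMeasure K |
      MeasurePreserving S (μ : Measure K) μ ∧ (μ : Measure K).map p = β} := by
  have invariant_lift_iff (μ : ProbabilityMeasure K) :
      (MeasurePreserving S (μ : Measure K) μ ∧ (μ : Measure K).map p = β) ↔
        μ.map hS.measurable.aemeasurable = μ ∧
          μ.map hp.measurable.aemeasurable = ⟨β, inferInstance⟩ :=
    ⟨fun h => ⟨Subtype.ext h.1.map_eq, Subtype.ext h.2⟩, fun h =>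
      ⟨⟨hS.measurable, congrArg ProbabilityMeasure.toMeasure h.1⟩,
        congrArg ProbabilityMeasure.toMeasure h.2⟩⟩
  simp only [invariant_lift_iff]
  exact (isClosed_eq (ProbabilityMeasure.continuous_map hS) continuous_id).inter
    (isClosed_eq (ProbabilityMeasure.continuous_map hp) continuous_const)

theorem exists_ergodic_lift [CompactSpace K] [T2Space K] (hS : Continuous S) (hp : Continuous p)
    (hpS : Function.Semiconj p S S') {β : Measure L} [IsProbabilityMeasure β] (hβ : Ergodic S' β)
    {ν : Measure K} [IsProbabilityMeasure ν] (hν : MeasurePreserving S ν ν) (hνβ : ν.map p = β) :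
    ∃ μ : Measure K, IsProbabilityMeasure μ ∧ Ergodic S μ ∧ μ.map p = β := by
  obtain ⟨μ, ⟨hμS, hμβ⟩, -, extreme⟩ :=
    exists_mem_extremePoints_of_isCompact (isClosed_setOf_invariant_lift hS hp β).isCompact
      ⟨⟨ν, inferInstance⟩, hν, hνβ⟩
  refine ⟨μ, inferInstance, Ergodic.of_mem_extremePoints ⟨⟨hμS, inferInstance⟩, ?_⟩, hμβ⟩
  rintro ν₁ ⟨hν₁, hν₁'⟩ ν₂ ⟨hν₂, hν₂'⟩ hseg
  have map_mem {ν : Measure K} (hν : MeasurePreserving S ν ν) (hν' : IsProbabilityMeasure ν) :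
      ν.map p ∈ {ν | MeasurePreserving S' ν ν ∧ IsProbabilityMeasure ν} :=
    ⟨(hp.measurable.measurePreserving ν).of_semiconj hν hpS hβ.measurable,
      Measure.isProbabilityMeasure_map hp.measurable.aemeasurable⟩
  have hsegβ : β ∈ openSegment ENNReal (ν₁.map p) (ν₂.map p) := by
    obtain ⟨a, b, ha, hb, hab, hμab⟩ := hseg
    exact ⟨a, b, ha, hb, hab, by
      rw [← hμβ, ← hμab, Measure.map_add _ _ hp.measurable, Measure.map_smul, Measure.map_smul]⟩
  have hβ₁ := hβ.mem_extremePoints.2 (map_mem hν₁ hν₁') (map_mem hν₂ hν₂') hsegβ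
  have hβ₂ := hβ.mem_extremePoints.2 (map_mem hν₂ hν₂') (map_mem hν₁ hν₁')
    (openSegment_symm ENNReal (ν₁.map p) _ ▸ hsegβ)
  exact extreme ⟨⟨ν₁, hν₁'⟩, ⟨hν₁, hβ₁⟩, rfl⟩ ⟨⟨ν₂, hν₂'⟩, ⟨hν₂, hβ₂⟩, rfl⟩ hseg

end ErgodicLifts

section Couplings

variable {X Y X₂ Y₂ : Type*} [MeasurableSpace X] [MeasurableSpace Y] [MeasurableSpace X₂]
  [MeasurableSpace Y₂] {μ : Measure X} {ν : Measure Y} {μ₂ : Measure X₂} {ν₂ : Measure Y₂}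
  {κ : Measure (X × Y)}

/-- `κ` is a coupling of `μ` and `ν`; unlike in `IsErgodicJoining`, no dynamics is involved. -/
structure IsCoupling (μ : Measure X) (ν : Measure Y) (κ : Measure (X × Y)) : Prop where
  map_fst : κ.map Prod.fst = μ
  map_snd : κ.map Prod.snd = ν

theorem isCoupling_graphJoining {R : X → Y} (hR : MeasurePreserving R μ ν) :
    IsCoupling μ ν (graphJoining μ R) := by
  have hgraph : Measurable fun x => (x, R x) := measurable_id.prodMk hR.measurable
  constructor
  · rw [graphJoining, Measure.map_map measurable_fst hgraph]
    exact Measure.map_id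
  · rw [graphJoining, Measure.map_map measurable_snd hgraph]
    exact hR.map_eq

namespace IsCoupling

theorem isProbabilityMeasure [IsProbabilityMeasure μ] (hκ : IsCoupling μ ν κ) :
    IsProbabilityMeasure κ :=
  have : IsProbabilityMeasure (κ.map Prod.fst) := by rwa [hκ.map_fst]
  Measure.isProbabilityMeasure_of_map Prod.fst

theorem map_prodMap (hκ : IsCoupling μ ν κ) {f : X → X₂} {g : Y → Y₂}
    (hf : MeasurePreserving f μ μ₂) (hg : MeasurePreserving g ν ν₂) :
    IsCoupling μ₂ ν₂ (κ.map (Prod.map f g)) := by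
  have hfg : Measurable (Prod.map f g) := hf.measurable.prodMap hg.measurable
  constructor
  · rw [Measure.map_map measurable_fst hfg, Prod.map_fst', ← Measure.map_map hf.measurable
      measurable_fst, hκ.map_fst, hf.map_eq]
  · rw [Measure.map_map measurable_snd hfg, Prod.map_snd', ← Measure.map_map hg.measurable
      measurable_snd, hκ.map_snd, hg.map_eq]

theorem prodMap_ae_eq (hκ : IsCoupling μ ν κ) {Z W : Type*} {f f' : X → Z} {g g' : Y → W}
    (hf : f =ᵐ[μ] f') (hg : g =ᵐ[ν] g') : Prod.map f g =ᵐ[κ] Prod.map f' g' := by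
  filter_upwards [ae_of_ae_map measurable_fst.aemeasurable (hκ.map_fst ▸ hf),
    ae_of_ae_map measurable_snd.aemeasurable (hκ.map_snd ▸ hg)] with q hq₁ hq₂
  exact Prod.ext hq₁ hq₂

theorem map_prodMap_of_ae_leftInverse (hκ : IsCoupling μ ν κ) {f : X → X₂} {g : Y → Y₂}
    {f' : X₂ → X} {g' : Y₂ → Y} (hf : Measurable f) (hg : Measurable g) (hf' : Measurable f')
    (hg' : Measurable g') (hff' : f' ∘ f =ᵐ[μ] id) (hgg' : g' ∘ g =ᵐ[ν] id) :
    (κ.map (Prod.map f g)).map (Prod.map f' g') = κ := by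
  rw [Measure.map_map (hf'.prodMap hg') (hf.prodMap hg), Prod.map_comp_map,
    Measure.map_congr (hκ.prodMap_ae_eq hff' hgg'), Prod.map_id, Measure.map_id]

end IsCoupling

end Couplings

section MeasureIsomorphisms

variable {X Y X₂ Y₂ : Type*} [MeasurableSpace X] [MeasurableSpace Y] [MeasurableSpace X₂]
  [MeasurableSpace Y₂] {μ : Measure X} {ν : Measure Y} {μ₂ : Measure X₂} {ν₂ : Measure Y₂}

theorem measurePreserving_perm_zpow {T : Equiv.Perm X} (hT : MeasurePreserving T μ μ)
    (hT' : Measurable T.symm) (n : ℤ) : MeasurePreserving ⇑(T ^ n) μ μ := by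
  let e : X ≃ᵐ X := ⟨T, hT.measurable, hT'⟩
  have he : MeasurePreserving ⇑T⁻¹ μ μ := MeasurePreserving.symm e hT
  induction n using Int.induction_on with
  | zero => exact MeasurePreserving.id μ
  | succ n ih => rw [zpow_add_one]; exact ih.comp hT
  | pred n ih => rw [zpow_sub_one]; exact ih.comp he

omit [MeasurableSpace Y] in
theorem ae_semiconj_perm_zpow {T : Equiv.Perm X} {S : Equiv.Perm Y} {R : X → Y}
    (hT : MeasurePreserving T μ μ) (hT' : Measurable T.symm) (hR : R ∘ T =ᵐ[μ] S ∘ R) (n : ℤ) :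
    R ∘ ⇑(T ^ n) =ᵐ[μ] ⇑(S ^ n) ∘ R := by
  have hTinv : MeasurePreserving ⇑T⁻¹ μ μ :=
    zpow_neg_one T ▸ measurePreserving_perm_zpow hT hT' (-1)
  have hRinv : R ∘ ⇑T⁻¹ =ᵐ[μ] ⇑S⁻¹ ∘ R := by
    filter_upwards [hTinv.quasiMeasurePreserving.ae_eq_comp hR] with x hx
    exact S.injective (by simpa using hx.symm)
  induction n using Int.induction_on with
  | zero => rfl
  | succ n ih =>
    rw [zpow_add_one, zpow_add_one]
    exact (hT.quasiMeasurePreserving.ae_eq_comp ih).trans (hR.fun_comp ⇑(S ^ (n : ℤ)))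
  | pred n ih =>
    rw [zpow_sub_one, zpow_sub_one]
    exact (hTinv.quasiMeasurePreserving.ae_eq_comp ih).trans (hRinv.fun_comp ⇑(S ^ (-n : ℤ)))

theorem measurePreserving_of_ae_semiconj {T : X → X} {S : Y → Y} {p : X → Y}
    (hT : MeasurePreserving T μ μ) (hS : Measurable S) (hp : MeasurePreserving p μ ν)
    (hpT : p ∘ T =ᵐ[μ] S ∘ p) : MeasurePreserving S ν ν := by
  refine ⟨hS, ?_⟩
  rw [← hp.map_eq, Measure.map_map hS hp.measurable, ← Measure.map_congr hpT,
    ← Measure.map_map hp.measurable hT.measurable, hT.map_eq]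

theorem ergodic_of_ae_semiconj {T : X → X} {S : Y → Y} {p : X → Y} (hT : Ergodic T μ)
    (hS : Measurable S) (hp : MeasurePreserving p μ ν) (hpT : p ∘ T =ᵐ[μ] S ∘ p) :
    Ergodic S ν := by
  refine ⟨measurePreserving_of_ae_semiconj hT.toMeasurePreserving hS hp hpT,
    ⟨fun A hA hSA => ?_⟩⟩
  have hTA : T ⁻¹' (p ⁻¹' A) =ᵐ[μ] p ⁻¹' A := by
    filter_upwards [hpT] with x hx
    exact congrArg (· ∈ A) hx |>.trans (congrArg (p x ∈ ·) hSA)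
  exact (hp.aeconst_preimage hA.nullMeasurableSet).1
    (hT.quasiErgodic.aeconst_set₀ (hp.measurable hA).nullMeasurableSet hTA)

namespace IsMeasureIso

variable {T : X → X} {S : Y → Y} {R : X → Y}

theorem exists_symm (hR : IsMeasureIso μ ν T S R) (hT : MeasurePreserving T μ μ) :
    ∃ R' : Y → X, IsMeasureIso ν μ S T R' ∧ R' ∘ R =ᵐ[μ] id ∧ R ∘ R' =ᵐ[ν] id := by
  obtain ⟨R', hR', hR'R, hRR'⟩ := hR.invertible
  have semiconj_at : R ∘ T ∘ R' =ᵐ[ν] S ∘ R ∘ R' :=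
    hR'.quasiMeasurePreserving.ae_eq_comp hR.equivariant
  have leftInverse_at : R' ∘ R ∘ T ∘ R' =ᵐ[ν] T ∘ R' :=
    (hT.comp hR').quasiMeasurePreserving.ae_eq_comp hR'R
  refine ⟨R', ⟨hR', ?_, R, hR.measurePreserving, hRR', hR'R⟩, hR'R, hRR'⟩
  filter_upwards [semiconj_at, leftInverse_at, hRR'] with y hy hy' hy''
  simp only [Function.comp_apply, id_eq] at *
  rw [← hy', hy, hy'']

theorem ergodic (hR : IsMeasureIso μ ν T S R) (hT : Ergodic T μ) (hS : Measurable S) :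
    Ergodic S ν :=
  ergodic_of_ae_semiconj hT hS hR.measurePreserving hR.equivariant

theorem zpow {T : Equiv.Perm X} {S : Equiv.Perm Y} (hR : IsMeasureIso μ ν T S R)
    (hT : MeasurePreserving T μ μ) (hT' : Measurable T.symm) (n : ℤ) :
    IsMeasureIso μ ν ⇑(T ^ n) ⇑(S ^ n) R :=
  ⟨hR.measurePreserving, ae_semiconj_perm_zpow hT hT' hR.equivariant n, hR.invertible⟩

theorem prodMap {T₂ : X₂ → X₂} {S₂ : Y₂ → Y₂} {R₂ : X₂ → Y₂} (hR : IsMeasureIso μ ν T S R)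
    (hR₂ : IsMeasureIso μ₂ ν₂ T₂ S₂ R₂) {κ : Measure (X × X₂)} (hκ : IsCoupling μ μ₂ κ) :
    IsMeasureIso κ (κ.map (Prod.map R R₂)) (Prod.map T T₂) (Prod.map S S₂) (Prod.map R R₂) := by
  obtain ⟨R', hR', hR'R, hRR'⟩ := hR.invertible
  obtain ⟨R₂', hR₂', hR₂'R₂, hR₂R₂'⟩ := hR₂.invertible
  have hRm := hR.measurePreserving
  have hR₂m := hR₂.measurePreserving
  refine ⟨(hRm.measurable.prodMap hR₂m.measurable).measurePreserving κ, ?_,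
    Prod.map R' R₂', ⟨hR'.measurable.prodMap hR₂'.measurable, ?_⟩, ?_, ?_⟩
  · simpa only [Prod.map_comp_map] using hκ.prodMap_ae_eq hR.equivariant hR₂.equivariant
  · exact hκ.map_prodMap_of_ae_leftInverse hRm.measurable hR₂m.measurable hR'.measurable
      hR₂'.measurable hR'R hR₂'R₂
  · simpa only [Prod.map_comp_map, Prod.map_id] using hκ.prodMap_ae_eq hR'R hR₂'R₂
  · simpa only [Prod.map_comp_map, Prod.map_id] using
      (hκ.map_prodMap hRm hR₂m).prodMap_ae_eq hRR' hR₂R₂'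

end IsMeasureIso

end MeasureIsomorphisms

section ErgodicDisintegration

variable {K H : Type*} [MeasurableSpace K] [MeasurableSpace H]

theorem eq_prod_map_snd_of_ergodic {S : K → K} {m : Measure K} [IsProbabilityMeasure m]
    (hS : Ergodic S m) {ξ : Measure (K × H)} (hξ : ξ.map (Prod.map S id) = ξ)
    (hξm : ξ.map Prod.fst = m) : ξ = m.prod (ξ.map Prod.snd) := by
  have : IsProbabilityMeasure (ξ.map Prod.fst) := by rwa [hξm]
  have : IsProbabilityMeasure ξ := Measure.isProbabilityMeasure_of_map Prod.fst
  refine (Measure.prod_eq fun s t hs ht => ?_).symm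
  have hA : MeasurableSet (Prod.snd ⁻¹' t : Set (K × H)) := measurable_snd ht
  let ξt : Measure K := (ξ.restrict (Prod.snd ⁻¹' t)).map Prod.fst
  have hSid : MeasurePreserving (Prod.map S id) ξ ξ := ⟨hS.measurable.prodMap measurable_id, hξ⟩
  have ξt_invariant : MeasurePreserving S ξt ξt :=
    MeasurePreserving.of_semiconj (measurable_fst.measurePreserving _)
      (hSid.restrict_preimage hA) (fun _ => rfl) hS.measurable
  have ξt_le : ξt ≤ m := hξm ▸ Measure.map_mono Measure.restrict_le_self measurable_fst
  obtain ⟨c, hc⟩ := hS.eq_smul_of_absolutelyContinuous ξt_invariant ξt_le.absolutelyContinuous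
  have ξt_apply {u : Set K} (hu : MeasurableSet u) : ξt u = ξ (u ×ˢ t) := by
    rw [Measure.map_apply measurable_fst hu, Measure.restrict_apply (measurable_fst hu),
      Set.prod_eq]
  have hc_eq : c = ξ.map Prod.snd t := by
    have := ξt_apply MeasurableSet.univ
    rwa [hc, Measure.smul_apply, measure_univ, smul_eq_mul, mul_one, Set.univ_prod,
      ← Measure.map_apply measurable_snd ht] at this
  rw [← ξt_apply hs, hc, Measure.smul_apply, hc_eq, smul_eq_mul, mul_comm]

theorem eq_of_map_prod_eq_ergodic {S : K → K} {m μ : Measure K} [IsProbabilityMeasure m]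
    [IsProbabilityMeasure μ] (hS : Ergodic S m) (hμ : MeasurePreserving S μ μ) {η : Measure H}
    [IsProbabilityMeasure η] {a b : K × H → K} (ha : Measurable a) (hb : Measurable b)
    (hab : ∀ z h, b (a (z, h), h) = z) (haS : ∀ z h, S (a (z, h)) = a (S z, h))
    (hμm : (μ.prod η).map a = m) (hm : (m.prod η).map a = m) : μ = m := by
  -- Ergodicity of `m` makes `a (z, h)` and `h` independent, and `z` is recovered from the two.
  have recover {ξ : Measure K} [IsProbabilityMeasure ξ] (hξ : MeasurePreserving S ξ ξ)
      (hξm : (ξ.prod η).map a = m) : ξ = (m.prod η).map b := by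
    let e : K × H → K × H := fun q => (a q, q.2)
    have he : Measurable e := ha.prodMk measurable_snd
    have fst_eq : ((ξ.prod η).map e).map Prod.fst = m := by
      rw [Measure.map_map measurable_fst he]
      exact hξm
    have snd_eq : ((ξ.prod η).map e).map Prod.snd = η := by
      rw [Measure.map_map measurable_snd he]
      exact measurePreserving_snd.map_eq
    have invariant : MeasurePreserving (Prod.map S id) ((ξ.prod η).map e) ((ξ.prod η).map e) :=
      MeasurePreserving.of_semiconj (he.measurePreserving _) (hξ.prod (MeasurePreserving.id η))
        (fun q => Prod.ext (haS q.1 q.2).symm rfl) (hS.measurable.prodMap measurable_id)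
    have product := eq_prod_map_snd_of_ergodic hS invariant.map_eq fst_eq
    rw [← snd_eq, ← product, Measure.map_map hb he, show b ∘ e = Prod.fst from
      funext fun q => hab q.1 q.2, measurePreserving_fst.map_eq]
  rw [recover hμ hμm, ← recover hS.toMeasurePreserving hm]

end ErgodicDisintegration

section GroupExtensions

variable {X G : Type*} [MeasurableSpace X] [MeasurableSpace G] [Group G] [MeasurableMul₂ G]
  {T : Equiv.Perm X} {ψ : X → G} {μ : Measure X} [IsProbabilityMeasure μ]
  {η : Measure G} [IsProbabilityMeasure η] [η.IsMulLeftInvariant]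

omit [IsProbabilityMeasure μ] [IsProbabilityMeasure η] in
theorem map_prod_mul_eq_prod [SFinite η] {ξ : Measure (X × G)} [SFinite ξ]
    (hξ : ξ.map Prod.fst = μ) :
    (ξ.prod η).map (fun q => (q.1.1, q.1.2 * q.2)) = μ.prod η := by
  have shear : MeasurePreserving (fun q : (X × G) × G => (q.1, q.1.2 * q.2))
      (ξ.prod η) (ξ.prod η) :=
    (MeasurePreserving.id ξ).skew_product (by fun_prop)
      (ae_of_all _ fun z => map_mul_left_eq_self η z.2)
  have project : MeasurePreserving (Prod.map Prod.fst id) (ξ.prod η) (μ.prod η) :=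
    (⟨measurable_fst, hξ⟩ : MeasurePreserving Prod.fst ξ μ).prod (MeasurePreserving.id η)
  exact (project.comp shear).map_eq

theorem eq_prod_of_ergodic_skewProduct [MeasurableInv G]
    (hψ : Ergodic (skewProduct T ψ) (μ.prod η)) {ξ : Measure (X × G)}
    (hξ : MeasurePreserving (skewProduct T ψ) ξ ξ) (hξμ : ξ.map Prod.fst = μ) :
    ξ = μ.prod η := by
  have : IsProbabilityMeasure (ξ.map Prod.fst) := by rwa [hξμ]
  have : IsProbabilityMeasure ξ := Measure.isProbabilityMeasure_of_map Prod.fst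
  exact eq_of_map_prod_eq_ergodic (b := fun q => (q.1.1, q.1.2 * q.2⁻¹)) hψ hξ (by fun_prop)
    (by fun_prop) (fun _ _ => Prod.ext rfl (mul_inv_cancel_right _ _))
    (fun _ _ => Prod.ext rfl (mul_assoc _ _ _).symm) (map_prod_mul_eq_prod hξμ)
    (map_prod_mul_eq_prod measurePreserving_fst.map_eq)

omit [IsProbabilityMeasure μ] in
theorem IsUniquelyErgodic.skewProduct [MeasurableInv G] (hT : IsUniquelyErgodic T μ)
    (hψ : Ergodic (skewProduct T ψ) (μ.prod η)) :
    IsUniquelyErgodic (skewProduct T ψ) (μ.prod η) := by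
  have := hT.isProbabilityMeasure
  refine ⟨inferInstance, hψ.toMeasurePreserving, fun ν _ hν =>
    eq_prod_of_ergodic_skewProduct hψ hν ?_⟩
  exact hT.unique _ (Measure.isProbabilityMeasure_map measurable_fst.aemeasurable)
    (MeasurePreserving.of_semiconj (measurable_fst.measurePreserving ν) hν (fun _ => rfl)
      hT.measurePreserving.measurable)

end GroupExtensions

section UniqueErgodicity

theorem isUniquelyErgodic_addRight {X : Type*} [AddCommGroup X] [MeasurableSpace X]
    [MeasurableAdd₂ X] [MeasurableNeg X] {b : X} {m : Measure X} [IsProbabilityMeasure m]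
    [m.IsAddLeftInvariant] (hb : Ergodic (Equiv.addRight b) m) :
    IsUniquelyErgodic (Equiv.addRight b) m := by
  have average (ξ : Measure X) [IsProbabilityMeasure ξ] :
      (ξ.prod m).map (fun q => q.1 + q.2) = m :=
    (measurePreserving_snd.comp <| (MeasurePreserving.id ξ).skew_product
      (g := fun x y => x + y) (by fun_prop) (ae_of_all _ fun x => map_add_left_eq_self m x)).map_eq
  refine ⟨inferInstance, hb.toMeasurePreserving, fun ν _ hν => ?_⟩
  exact eq_of_map_prod_eq_ergodic (b := fun q => q.1 + -q.2) hb hν (by fun_prop) (by fun_prop)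
    (fun _ _ => add_neg_cancel_right _ _) (fun _ _ => add_right_comm _ _ _) (average ν) (average m)

namespace IsUniquelyErgodic

variable {X : Type*} [MeasurableSpace X] {μ : Measure X}

theorem isCoupling {Y : Type*} [MeasurableSpace Y] {ν : Measure Y} {T : X → X} {S : Y → Y}
    (hT : IsUniquelyErgodic T μ) (hS : IsUniquelyErgodic S ν) {κ : Measure (X × Y)}
    [IsProbabilityMeasure κ] (hκ : MeasurePreserving (Prod.map T S) κ κ) : IsCoupling μ ν κ where
  map_fst := hT.unique _ (Measure.isProbabilityMeasure_map measurable_fst.aemeasurable)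
    (MeasurePreserving.of_semiconj (measurable_fst.measurePreserving κ) hκ (fun _ => rfl)
      hT.measurePreserving.measurable)
  map_snd := hS.unique _ (Measure.isProbabilityMeasure_map measurable_snd.aemeasurable)
    (MeasurePreserving.of_semiconj (measurable_snd.measurePreserving κ) hκ (fun _ => rfl)
      hS.measurePreserving.measurable)

theorem absolutelyContinuous_of_iterate {T : X → X} (hT : IsUniquelyErgodic T μ) {n : ℕ}
    (hn : n ≠ 0) {ν : Measure X} [IsProbabilityMeasure ν] (hν : MeasurePreserving T^[n] ν ν) :
    ν ≪ μ := by
  have hTm := hT.measurePreserving.measurable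
  let ξ : Measure X := ∑ i ∈ Finset.range n, ν.map T^[i]
  have map_iterate_succ (i : ℕ) : (ν.map T^[i]).map T = ν.map T^[i + 1] := by
    rw [Measure.map_map hTm (hTm.iterate i), Function.iterate_succ']
  have ξ_invariant : ξ.map T = ξ := by
    rw [← Measure.mapₗ_apply_of_measurable hTm, map_sum]
    simp only [Measure.mapₗ_apply_of_measurable hTm, map_iterate_succ, ξ]
    obtain ⟨k, rfl⟩ := Nat.exists_eq_succ_of_ne_zero hn
    rw [Finset.sum_range_succ, Finset.sum_range_succ', hν.map_eq, Function.iterate_zero,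
      Measure.map_id]
  have ξ_univ : ξ Set.univ = n := by
    have (i : ℕ) : IsProbabilityMeasure (ν.map T^[i]) :=
      Measure.isProbabilityMeasure_map (hTm.iterate i).aemeasurable
    simp [ξ, Measure.finsetSum_apply]
  have hn' : (n : ENNReal)⁻¹ * n = 1 :=
    ENNReal.inv_mul_cancel (Nat.cast_ne_zero.2 hn) (ENNReal.natCast_ne_top n)
  have average_eq : (n : ENNReal)⁻¹ • ξ = μ :=
    hT.unique _ ⟨by rw [Measure.smul_apply, ξ_univ, smul_eq_mul, hn']⟩
      ⟨hTm, by rw [Measure.map_smul, ξ_invariant]⟩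
  have ν_le : ν ≤ ξ := by
    calc ν = ν.map T^[0] := Measure.map_id.symm
      _ ≤ ξ := Finset.single_le_sum (f := fun i => ν.map T^[i])
        (fun i _ => Measure.zero_le _) (Finset.mem_range.2 (Nat.pos_of_ne_zero hn))
  rw [← average_eq]
  exact ν_le.absolutelyContinuous.trans
    (Measure.absolutelyContinuous_smul (ENNReal.inv_ne_zero.2 (ENNReal.natCast_ne_top n)))

theorem zpow {T : Equiv.Perm X} (hT : IsUniquelyErgodic T μ) (hT' : Measurable T.symm) {n : ℤ}
    (hn : n ≠ 0) (hTn : Ergodic ⇑(T ^ n) μ) : IsUniquelyErgodic ⇑(T ^ n) μ := by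
  have := hT.isProbabilityMeasure
  refine ⟨this, hTn.toMeasurePreserving, fun ν _ hν => ?_⟩
  have symm_measurable : Measurable (T ^ n).symm := by
    rw [← Equiv.Perm.inv_def, ← zpow_neg]
    exact (measurePreserving_perm_zpow hT.measurePreserving hT' (-n)).measurable
  have hν' : MeasurePreserving T^[n.natAbs] ν ν := by
    have := measurePreserving_perm_zpow hν symm_measurable n.sign
    rwa [← zpow_mul, Int.mul_sign_self, zpow_natCast, ← Equiv.Perm.iterate_eq_pow] at this
  exact hTn.eq_of_absolutelyContinuous hν
    (hT.absolutelyContinuous_of_iterate (Int.natAbs_ne_zero.2 hn) hν')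

end IsUniquelyErgodic

end UniqueErgodicity

section Powers

theorem semiconj_perm_zpow {X Y : Type*} {T : Equiv.Perm X} {S : Equiv.Perm Y} {p : X → Y}
    (h : Function.Semiconj p T S) (n : ℤ) : Function.Semiconj p ⇑(T ^ n) ⇑(S ^ n) := by
  have hinv : Function.Semiconj p ⇑T⁻¹ ⇑S⁻¹ :=
    h.inverses_right T.rightInverse_symm S.leftInverse_symm
  induction n using Int.induction_on with
  | zero => exact fun _ => rfl
  | succ n ih => rw [zpow_add_one, zpow_add_one]; exact ih.comp_right h
  | pred n ih => rw [zpow_sub_one, zpow_sub_one]; exact ih.comp_right hinv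

theorem continuous_perm_zpow {X : Type*} [TopologicalSpace X] {T : Equiv.Perm X} (hT : Continuous T)
    (hT' : Continuous T.symm) (n : ℤ) : Continuous ⇑(T ^ n) := by
  induction n using Int.induction_on with
  | zero => exact continuous_id
  | succ n ih => rw [zpow_add_one]; exact ih.comp hT
  | pred n ih => rw [zpow_sub_one]; exact ih.comp hT'

end Powers

section SkewProducts

variable {X Y G H : Type*} [Group G] [Group H]

/-- The cocycle `ψ⁽ⁿ⁾` with `(T_ψ)ⁿ (x, g) = (Tⁿ x, ψ⁽ⁿ⁾(x) g)`, for `n` of either sign. -/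
def skewCocycle (T : Equiv.Perm X) (ψ : X → G) (n : ℤ) (x : X) : G :=
  ((skewProduct T ψ ^ n) (x, 1)).2

theorem skewProduct_zpow (T : Equiv.Perm X) (ψ : X → G) (n : ℤ) :
    skewProduct T ψ ^ n = skewProduct (T ^ n) (skewCocycle T ψ n) := by
  ext1 ⟨x, g⟩
  have base : Function.Semiconj Prod.fst (skewProduct T ψ) T := fun _ => rfl
  have mul_right : Function.Semiconj (fun q : X × G => (q.1, q.2 * g))
      (skewProduct T ψ) (skewProduct T ψ) := fun q => Prod.ext rfl (mul_assoc _ _ _)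
  refine Prod.ext (semiconj_perm_zpow base n (x, g)) ?_
  have snd_eq := congrArg Prod.snd (semiconj_perm_zpow mul_right n (x, 1))
  simp only [one_mul] at snd_eq
  exact snd_eq.symm

section Continuity

variable [TopologicalSpace X] [TopologicalSpace G] [IsTopologicalGroup G] {T : Equiv.Perm X}
  {ψ : X → G}

theorem continuous_skewProduct (hT : Continuous T) (hψ : Continuous ψ) :
    Continuous (skewProduct T ψ) :=
  (hT.comp continuous_fst).prodMk ((hψ.comp continuous_fst).mul continuous_snd)

theorem continuous_skewProduct_symm (hT' : Continuous T.symm) (hψ : Continuous ψ) :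
    Continuous (skewProduct T ψ).symm :=
  have hT'_fst : Continuous fun q : X × G => T.symm q.1 := hT'.comp continuous_fst
  hT'_fst.prodMk ((hψ.comp hT'_fst).inv.mul continuous_snd)

theorem continuous_skewCocycle (hT : Continuous T) (hT' : Continuous T.symm) (hψ : Continuous ψ)
    (n : ℤ) : Continuous (skewCocycle T ψ n) :=
  continuous_snd.comp <| (continuous_perm_zpow (continuous_skewProduct hT hψ)
    (continuous_skewProduct_symm hT' hψ) n).comp (continuous_id.prodMk continuous_const)

end Continuity

variable [MeasurableSpace X] [MeasurableSpace Y] [MeasurableSpace G] [MeasurableSpace H]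

instance measurableMul₂_prod [MeasurableMul₂ G] [MeasurableMul₂ H] : MeasurableMul₂ (G × H) :=
  ⟨by simp only [Prod.mul_def]; fun_prop⟩

instance measurableInv_prod [MeasurableInv G] [MeasurableInv H] : MeasurableInv (G × H) :=
  ⟨(measurable_inv.comp measurable_fst).prodMk (measurable_inv.comp measurable_snd)⟩

theorem measurePreserving_skewProduct [MeasurableMul₂ G] {T : Equiv.Perm X} {ψ : X → G}
    {μ : Measure X} [SFinite μ] {η : Measure G} [SFinite η] [η.IsMulLeftInvariant]
    (hT : MeasurePreserving T μ μ) (hψ : Measurable ψ) :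
    MeasurePreserving (skewProduct T ψ) (μ.prod η) (μ.prod η) :=
  hT.skew_product (g := fun x g => ψ x * g) (by fun_prop)
    (ae_of_all _ fun x => map_mul_left_eq_self η (ψ x))

theorem IsMeasureIso.skewProduct {T : Equiv.Perm X} {S : Equiv.Perm Y} {μ : Measure X}
    {ν : Measure Y} [SFinite μ] [SFinite ν] {R : X → Y} (hR : IsMeasureIso μ ν T S R) {ψ : X → G}
    {φ : Y → G} (hψ : ψ =ᵐ[μ] φ ∘ R) (η : Measure G) [SFinite η] :
    IsMeasureIso (μ.prod η) (ν.prod η) (skewProduct T ψ) (skewProduct S φ) (Prod.map R id) := by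
  obtain ⟨R', hR', hR'R, hRR'⟩ := hR.invertible
  have hX := Measure.quasiMeasurePreserving_fst (μ := μ) (ν := η)
  have hY := Measure.quasiMeasurePreserving_fst (μ := ν) (ν := η)
  refine ⟨hR.measurePreserving.prod (MeasurePreserving.id η), ?_, Prod.map R' id,
    hR'.prod (MeasurePreserving.id η), ?_, ?_⟩
  · filter_upwards [hX.ae hR.equivariant, hX.ae hψ] with q hq hq'
    exact Prod.ext hq (congrArg (· * q.2) hq')
  · filter_upwards [hX.ae hR'R] with q hq using Prod.ext hq rfl
  · filter_upwards [hY.ae hRR'] with q hq using Prod.ext hq rfl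

end SkewProducts

section RelativelyIndependentExtensions

variable {X Y G H : Type*} [MeasurableSpace X] [MeasurableSpace Y] [MeasurableSpace G]
  [MeasurableSpace H]

/-- The regrouping `((x, y), (g, h)) ↦ ((x, g), (y, h))`, which carries the extension of `X × Y` by
`G × H` to the product of the extensions of `X` by `G` and of `Y` by `H`. -/
def prodRegroup (X Y G H : Type*) [MeasurableSpace X] [MeasurableSpace Y] [MeasurableSpace G]
    [MeasurableSpace H] : (X × Y) × (G × H) ≃ᵐ (X × G) × (Y × H) where
  toEquiv := Equiv.prodProdProdComm X Y G H
  measurable_toFun := by dsimp [Equiv.prodProdProdComm]; fun_prop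
  measurable_invFun := by dsimp [Equiv.prodProdProdComm]; fun_prop

theorem condDistrib_id_fst_prod [StandardBorelSpace (X × G)] [Nonempty (X × G)] (μ : Measure X)
    [IsProbabilityMeasure μ] (η : Measure G) [IsProbabilityMeasure η] :
    ∀ᵐ x ∂μ, condDistrib id Prod.fst (μ.prod η) x = η.map (Prod.mk x) := by
  let κ : Kernel X (X × G) := ⟨fun x => η.map (Prod.mk x), Measurable.map_prodMk_left⟩
  have : IsMarkovKernel κ := ⟨fun x => Measure.isProbabilityMeasure_map (by fun_prop)⟩
  have disintegration : (μ.prod η).map (fun q => (q.1, q)) = μ.compProd κ := by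
    ext A hA
    have hm : Measurable fun q : X × G => (q.1, q) := by fun_prop
    rw [Measure.compProd_apply hA, Measure.map_apply hm hA, Measure.prod_apply (hm hA)]
    refine lintegral_congr fun x => ?_
    exact (Measure.map_apply measurable_prodMk_left (measurable_prodMk_left hA)).symm
  have key := condDistrib_ae_eq_of_measure_eq_compProd (μ := μ.prod η) (Y := id) (κ := κ)
    Prod.fst aemeasurable_id (by rwa [measurePreserving_fst.map_eq])
  rwa [measurePreserving_fst.map_eq] at key

variable {μ : Measure X} {ν : Measure Y} {η : Measure G} {θ : Measure H} {ρ : Measure (X × Y)}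
  [IsProbabilityMeasure μ] [IsProbabilityMeasure ν] [IsProbabilityMeasure η]
  [IsProbabilityMeasure θ] [StandardBorelSpace (X × G)] [Nonempty (X × G)]
  [StandardBorelSpace (Y × H)] [Nonempty (Y × H)]

theorem map_prodRegroup_prod (hρ : IsCoupling μ ν ρ) :
    (ρ.prod (η.prod θ)).map (prodRegroup X Y G H) =
      relIndepExtension (μ.prod η) (ν.prod θ) Prod.fst Prod.fst ρ := by
  have := hρ.isProbabilityMeasure
  ext A hA
  rw [relIndepExtension, Measure.bind_apply hA (Kernel.aemeasurable _),
    Measure.map_apply (prodRegroup X Y G H).measurable hA,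
    Measure.prod_apply ((prodRegroup X Y G H).measurable hA)]
  refine lintegral_congr_ae ?_
  have hfst : MeasurePreserving Prod.fst ρ μ := ⟨measurable_fst, hρ.map_fst⟩
  have hsnd : MeasurePreserving Prod.snd ρ ν := ⟨measurable_snd, hρ.map_snd⟩
  filter_upwards [hfst.quasiMeasurePreserving.ae (condDistrib_id_fst_prod μ η),
    hsnd.quasiMeasurePreserving.ae (condDistrib_id_fst_prod ν θ)] with q hq₁ hq₂
  rw [Kernel.parallelComp_apply, hq₁, hq₂, Measure.map_prod_map _ _ (by fun_prop) (by fun_prop),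
    Measure.map_apply (by fun_prop) hA]
  rfl

theorem measurePreserving_prodRegroup (hρ : IsCoupling μ ν ρ) :
    MeasurePreserving (prodRegroup X Y G H) (ρ.prod (η.prod θ))
      (relIndepExtension (μ.prod η) (ν.prod θ) Prod.fst Prod.fst ρ) :=
  ⟨(prodRegroup X Y G H).measurable, map_prodRegroup_prod hρ⟩

theorem isCoupling_relIndepExtension (hρ : IsCoupling μ ν ρ) :
    IsCoupling (μ.prod η) (ν.prod θ)
      (relIndepExtension (μ.prod η) (ν.prod θ) Prod.fst Prod.fst ρ) := by
  have := hρ.isProbabilityMeasure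
  have hr := (prodRegroup X Y G H).measurable
  rw [← map_prodRegroup_prod hρ]
  constructor
  · rw [Measure.map_map measurable_fst hr]
    exact (MeasurePreserving.prod ⟨measurable_fst, hρ.map_fst⟩ measurePreserving_fst).map_eq
  · rw [Measure.map_map measurable_snd hr]
    exact (MeasurePreserving.prod ⟨measurable_snd, hρ.map_snd⟩ measurePreserving_snd).map_eq

theorem map_prodMap_fst_relIndepExtension (hρ : IsCoupling μ ν ρ) :
    (relIndepExtension (μ.prod η) (ν.prod θ) Prod.fst Prod.fst ρ).map
      (Prod.map Prod.fst Prod.fst) = ρ := by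
  have := hρ.isProbabilityMeasure
  rw [← map_prodRegroup_prod hρ, Measure.map_map (measurable_fst.prodMap measurable_fst)
    (prodRegroup X Y G H).measurable]
  exact measurePreserving_fst.map_eq

theorem map_relIndepExtension {X₂ Y₂ : Type*} [MeasurableSpace X₂] [MeasurableSpace Y₂]
    [StandardBorelSpace (X₂ × G)] [Nonempty (X₂ × G)] [StandardBorelSpace (Y₂ × H)]
    [Nonempty (Y₂ × H)] {μ₂ : Measure X₂} {ν₂ : Measure Y₂} [IsProbabilityMeasure μ₂]
    [IsProbabilityMeasure ν₂] {f : X → X₂} {g : Y → Y₂} (hf : MeasurePreserving f μ μ₂)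
    (hg : MeasurePreserving g ν ν₂) (hρ : IsCoupling μ ν ρ) :
    (relIndepExtension (μ.prod η) (ν.prod θ) Prod.fst Prod.fst ρ).map
        (Prod.map (Prod.map f id) (Prod.map g id)) =
      relIndepExtension (μ₂.prod η) (ν₂.prod θ) Prod.fst Prod.fst (ρ.map (Prod.map f g)) := by
  have := hρ.isProbabilityMeasure
  have hfg : Measurable (Prod.map f g) := hf.measurable.prodMap hg.measurable
  have hfg' : Measurable (Prod.map (Prod.map f (id : G → G)) (Prod.map g (id : H → H))) :=
    (hf.measurable.prodMap measurable_id).prodMap (hg.measurable.prodMap measurable_id)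
  have base : (ρ.prod (η.prod θ)).map (Prod.map (Prod.map f g) id) =
      (ρ.map (Prod.map f g)).prod (η.prod θ) :=
    ((hfg.measurePreserving ρ).prod (MeasurePreserving.id (η.prod θ))).map_eq
  rw [← map_prodRegroup_prod hρ, ← map_prodRegroup_prod (hρ.map_prodMap hf hg), ← base,
    Measure.map_map hfg' (prodRegroup X Y G H).measurable,
    Measure.map_map (prodRegroup X₂ Y₂ G H).measurable (hfg.prodMap measurable_id)]
  rfl

theorem isMeasureIso_relIndepExtension {X₂ Y₂ : Type*} [MeasurableSpace X₂] [MeasurableSpace Y₂]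
    [StandardBorelSpace (X₂ × G)] [Nonempty (X₂ × G)] [StandardBorelSpace (Y₂ × H)]
    [Nonempty (Y₂ × H)] {μ₂ : Measure X₂} {ν₂ : Measure Y₂} [IsProbabilityMeasure μ₂]
    [IsProbabilityMeasure ν₂] {f : X → X₂} {g : Y → Y₂} (hf : MeasurePreserving f μ μ₂)
    (hg : MeasurePreserving g ν ν₂) (hρ : IsCoupling μ ν ρ) {P : X × G → X × G}
    {P₂ : X₂ × G → X₂ × G} {Q : Y × H → Y × H} {Q₂ : Y₂ × H → Y₂ × H}
    (hP : IsMeasureIso (μ.prod η) (μ₂.prod η) P P₂ (Prod.map f id))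
    (hQ : IsMeasureIso (ν.prod θ) (ν₂.prod θ) Q Q₂ (Prod.map g id)) :
    IsMeasureIso (relIndepExtension (μ.prod η) (ν.prod θ) Prod.fst Prod.fst ρ)
      (relIndepExtension (μ₂.prod η) (ν₂.prod θ) Prod.fst Prod.fst (ρ.map (Prod.map f g)))
      (Prod.map P Q) (Prod.map P₂ Q₂) (Prod.map (Prod.map f id) (Prod.map g id)) :=
  map_relIndepExtension (η := η) (θ := θ) hf hg hρ ▸
    hP.prodMap hQ (isCoupling_relIndepExtension hρ)

variable [Group G] [Group H] {T : Equiv.Perm X} {U : Equiv.Perm Y} {ψ : X → G} {φ : Y → H}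
  [MeasurableMul₂ G] [MeasurableMul₂ H] [η.IsMulLeftInvariant] [θ.IsMulLeftInvariant]

theorem measurePreserving_relIndepExtension (hρ : IsCoupling μ ν ρ) (hψ : Measurable ψ)
    (hφ : Measurable φ) (hTU : MeasurePreserving (Prod.map T U) ρ ρ) :
    MeasurePreserving (Prod.map (skewProduct T ψ) (skewProduct U φ))
      (relIndepExtension (μ.prod η) (ν.prod θ) Prod.fst Prod.fst ρ)
      (relIndepExtension (μ.prod η) (ν.prod θ) Prod.fst Prod.fst ρ) := by
  have := hρ.isProbabilityMeasure
  have regroup : MeasurePreserving (prodRegroup X Y G H) (ρ.prod (η.prod θ))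
      (relIndepExtension (μ.prod η) (ν.prod θ) Prod.fst Prod.fst ρ) :=
    measurePreserving_prodRegroup hρ
  exact regroup.comp ((measurePreserving_skewProduct (T := T.prodCongr U) hTU
    (hψ.prodMap hφ)).comp (regroup.symm _))

theorem isUniqueInvariantLift_relIndepExtension [MeasurableInv G] [MeasurableInv H]
    (hρ : IsCoupling μ ν ρ)
    (herg : Ergodic (Prod.map (skewProduct T ψ) (skewProduct U φ))
      (relIndepExtension (μ.prod η) (ν.prod θ) Prod.fst Prod.fst ρ)) :
    IsUniqueInvariantLift (Prod.map (skewProduct T ψ) (skewProduct U φ))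
      (Prod.map Prod.fst Prod.fst) ρ
      (relIndepExtension (μ.prod η) (ν.prod θ) Prod.fst Prod.fst ρ) := by
  have := hρ.isProbabilityMeasure
  refine ⟨(isCoupling_relIndepExtension hρ).isProbabilityMeasure, herg.toMeasurePreserving,
    map_prodMap_fst_relIndepExtension hρ, fun ξ _ hξ hξρ => ?_⟩
  let e := prodRegroup X Y G H
  have regroup : MeasurePreserving e (ρ.prod (η.prod θ))
      (relIndepExtension (μ.prod η) (ν.prod θ) Prod.fst Prod.fst ρ) :=
    measurePreserving_prodRegroup hρ
  have skew_ergodic : Ergodic (skewProduct (T.prodCongr U) (Prod.map ψ φ)) (ρ.prod (η.prod θ)) :=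
    regroup.ergodic_conjugate_iff.1 herg
  have ungroup : MeasurePreserving e.symm ξ (ξ.map e.symm) := e.symm.measurable.measurePreserving ξ
  have invariant : MeasurePreserving (skewProduct (T.prodCongr U) (Prod.map ψ φ))
      (ξ.map e.symm) (ξ.map e.symm) :=
    MeasurePreserving.of_semiconj ungroup hξ (fun _ => rfl) skew_ergodic.measurable
  have base : (ξ.map e.symm).map Prod.fst = ρ := by
    rw [Measure.map_map measurable_fst e.symm.measurable, ← hξρ]
    rfl
  rw [← regroup.map_eq, ← eq_prod_of_ergodic_skewProduct skew_ergodic invariant base,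
    e.map_map_symm]

end RelativelyIndependentExtensions

section Rotations

theorem addRight_zpow {X : Type*} [AddGroup X] (a : X) (n : ℤ) :
    Equiv.addRight a ^ n = Equiv.addRight (n • a) := by
  induction n using Int.induction_on with
  | zero => ext x; simp
  | succ n ih =>
    rw [← mul_self_zpow, ih, add_one_zsmul]
    ext x
    simp [add_assoc]
  | pred n ih =>
    rw [sub_one_zsmul, sub_eq_neg_add, zpow_add, zpow_neg_one, ih]
    ext x
    simp [add_assoc]

theorem exists_ergodic_isGeneric_addRight {X : Type*} [AddCommGroup X] [TopologicalSpace X]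
    [IsTopologicalAddGroup X] [CompactSpace X] [PolishSpace X] [MeasurableSpace X] [BorelSpace X]
    (b y : X) :
    ∃ β : Measure X, IsProbabilityMeasure β ∧ Ergodic (Equiv.addRight b) β ∧
      IsGeneric (Equiv.addRight b) y β := by
  let H : AddSubgroup X := (AddSubgroup.zmultiples b).topologicalClosure
  have hH : IsClosed (H : Set X) := (AddSubgroup.zmultiples b).isClosed_topologicalClosure
  have : CompactSpace H := isCompact_iff_compactSpace.1 hH.isCompact
  have : PolishSpace H := hH.polishSpace
  let c : H := ⟨b, subset_closure (AddSubgroup.mem_zmultiples b)⟩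
  let m : Measure H := Measure.addHaarMeasure ⊤
  have : IsProbabilityMeasure m := ⟨Measure.addHaarMeasure_self⟩
  have dense : DenseRange fun n : ℤ => n • c := fun h => by
    rw [closure_subtype, ← Set.range_comp]
    exact h.2
  have rotation_eq : (c + ·) = ⇑(Equiv.addRight c) := funext fun h => add_comm c h
  have ergodic : Ergodic (Equiv.addRight c) m :=
    rotation_eq ▸ ergodic_add_left_of_denseRange_zsmul dense m
  have generic : IsGeneric (Equiv.addRight c) 0 m :=
    (isUniquelyErgodic_addRight ergodic).isGeneric (continuous_add_const c) 0
  have translate_continuous : Continuous fun h : H => y + h := by fun_prop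
  have translate_semiconj :
      Function.Semiconj (fun h : H => y + h) (Equiv.addRight c) (Equiv.addRight b) :=
    fun h => (add_assoc y (h : X) b).symm
  refine ⟨m.map fun h : H => y + h,
    Measure.isProbabilityMeasure_map translate_continuous.aemeasurable,
    MeasurePreserving.ergodic_of_ergodic_semiconj
      (translate_continuous.measurable.measurePreserving m) ergodic (measurable_add_const b)
      translate_semiconj, ?_⟩
  simpa using generic.map translate_continuous translate_semiconj

theorem exists_isGeneric_coupling_addRight {X Y : Type*} [AddCommGroup X] [TopologicalSpace X]
    [IsTopologicalAddGroup X] [CompactSpace X] [PolishSpace X] [MeasurableSpace X] [BorelSpace X]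
    [AddCommGroup Y] [TopologicalSpace Y] [IsTopologicalAddGroup Y] [CompactSpace Y]
    [PolishSpace Y] [MeasurableSpace Y] [BorelSpace Y] {μ : Measure X} [IsProbabilityMeasure μ]
    [μ.IsAddLeftInvariant] {ν : Measure Y} [IsProbabilityMeasure ν] [ν.IsAddLeftInvariant]
    {T : X → X} {S : Y → Y} {a : X} {b : Y} (hTa : T = Equiv.addRight a)
    (hSb : S = Equiv.addRight b) (hT : Ergodic T μ) (hS : Ergodic S ν) (x : X) (y : Y) :
    ∃ κ, IsCoupling μ ν κ ∧ Ergodic (Prod.map T S) κ ∧ IsGeneric (Prod.map T S) (x, y) κ := by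
  subst hTa hSb
  obtain ⟨κ, _, hκ, generic⟩ := exists_ergodic_isGeneric_addRight (a, b) (x, y)
  exact ⟨κ, (isUniquelyErgodic_addRight hT).isCoupling (isUniquelyErgodic_addRight hS)
    hκ.toMeasurePreserving, hκ, generic⟩

theorem isMeasureIso_of_semiconj_addRight {X X' : Type*} [AddGroup X] [MeasurableSpace X]
    [MeasurableAdd₂ X] [MeasurableNeg X] [MeasurableSpace.CountablySeparated X]
    [MeasurableSpace X'] {m : Measure X} [m.IsAddLeftInvariant]
    {μ : Measure X'} {a : X} {S : X' → X'} {π : X' → X} (ha : Ergodic (Equiv.addRight a) m)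
    (hπ : Measurable π) (hπS : Function.Semiconj π S (Equiv.addRight a))
    (hiso : MeasureIsomorphic m μ (Equiv.addRight a) S) :
    IsMeasureIso μ m S (Equiv.addRight a) π := by
  obtain ⟨R, hR, hRS, R', hR', -, hRR'⟩ := hiso
  -- `π ∘ R` commutes with the ergodic rotation, hence is itself a translation.
  obtain ⟨c, hc⟩ : ∃ c, (fun x => π (R x) - x) =ᵐ[m] Function.const X c := by
    refine ha.quasiErgodic.ae_eq_const_of_ae_eq_comp₀
      ((hπ.comp hR.measurable).sub measurable_id).nullMeasurable ?_
    filter_upwards [hRS] with x hx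
    have hπR : π (R (x + a)) = π (R x) + a := (congrArg π hx).trans (hπS (R x))
    simp [hπR, sub_eq_add_neg, add_assoc]
  have translation : π ∘ R =ᵐ[m] (c + ·) := by
    filter_upwards [hc] with x hx using sub_eq_iff_eq_add.1 hx
  have map_eq : μ.map π = m := by
    rw [← hR.map_eq, Measure.map_map hπ hR.measurable, Measure.map_congr translation,
      map_add_left_eq_self]
  refine ⟨⟨hπ, map_eq⟩, ae_of_all _ hπS, fun x => R (-c + x),
    hR.comp (measurePreserving_add_left m (-c)), ?_, ?_⟩
  · filter_upwards [hRR', hR'.quasiMeasurePreserving.ae_eq_comp translation] with y hy hy'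
    simp only [Function.comp_apply, id_eq] at *
    rw [← congrArg π hy, hy', neg_add_cancel_left, hy]
  · filter_upwards [(measurePreserving_add_left m (-c)).quasiMeasurePreserving.ae_eq_comp
      translation] with x hx
    exact hx.trans (add_neg_cancel_left c x)

end Rotations

section MeasurePreservingMaps

variable {X Y : Type*} [MeasurableSpace X] [MeasurableSpace Y] {μ : Measure X} {ν : Measure Y}

theorem ergodic_of_ergodic_zpow {T : Equiv.Perm X} (hT : MeasurePreserving T μ μ) {n : ℤ}
    (hTn : Ergodic ⇑(T ^ n) μ) : Ergodic T μ := by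
  refine ⟨hT, ⟨fun A hA hTA => hTn.aeconst_set hA (Set.ext fun x => ?_)⟩⟩
  have invariant : Function.Semiconj (· ∈ A) T (1 : Equiv.Perm Prop) :=
    fun x => congrArg (x ∈ ·) hTA
  have := semiconj_perm_zpow invariant n x
  rw [one_zpow] at this
  exact this.to_iff

theorem ergodic_zpow_of_ergodic_skewProduct_zpow {G : Type*} [MeasurableSpace G] [Group G]
    {T : Equiv.Perm X} {ψ : X → G} {η : Measure G} [IsProbabilityMeasure η] {n : ℤ}
    (hTn : Measurable ⇑(T ^ n)) (hn : Ergodic ⇑(skewProduct T ψ ^ n) (μ.prod η)) :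
    Ergodic ⇑(T ^ n) μ :=
  ergodic_of_ae_semiconj hn hTn measurePreserving_fst
    (ae_of_all _ (semiconj_perm_zpow (p := Prod.fst) (fun _ => rfl) n))

theorem ergodic_graphJoining {T : X → X} {S : Y → Y} {R : X → Y} (hT : Ergodic T μ)
    (hS : Measurable S) (hR : IsMeasureIso μ ν T S R) :
    Ergodic (Prod.map T S) (graphJoining μ R) := by
  have hgraph : Measurable fun x => (x, R x) :=
    measurable_id.prodMk hR.measurePreserving.measurable
  refine ergodic_of_ae_semiconj hT (hT.measurable.prodMap hS) (hgraph.measurePreserving μ) ?_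
  filter_upwards [hR.equivariant] with x hx using Prod.ext rfl hx

end MeasurePreservingMaps

section IsomorphicExtensions

variable {X X' : Type*} [TopologicalSpace X] [MeasurableSpace X] [TopologicalSpace X']
  [MeasurableSpace X']

/-- `π` presents the uniquely ergodic system `(X', T')` as a topological extension of `(X, T)` that
is at the same time a measure-theoretic isomorphism of `(X', μ', T')` with `(X, μ, T)`: an
*isomorphic extension*. -/
structure IsIsomorphicExtension (T' : X' → X') (μ' : Measure X') (T : X → X) (μ : Measure X)
    (π : X' → X) : Prop where
  continuous_map : Continuous T'
  isUniquelyErgodic : IsUniquelyErgodic T' μ'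
  continuous : Continuous π
  semiconj : Function.Semiconj π T' T
  isMeasureIso : IsMeasureIso μ' μ T' T π

namespace IsIsomorphicExtension

variable {μ' : Measure X'} {μ : Measure X} {π : X' → X}

theorem zpow [BorelSpace X'] {T' : Equiv.Perm X'} {T : Equiv.Perm X}
    (h : IsIsomorphicExtension T' μ' T μ π) (hT' : Continuous T'.symm) {n : ℤ} (hn : n ≠ 0)
    (hTn : Ergodic ⇑(T ^ n) μ) : IsIsomorphicExtension ⇑(T' ^ n) μ' ⇑(T ^ n) μ π := by
  have preserving := h.isUniquelyErgodic.measurePreserving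
  have preserving_zpow := measurePreserving_perm_zpow preserving hT'.measurable n
  have iso_zpow := h.isMeasureIso.zpow preserving hT'.measurable n
  obtain ⟨σ, hσ, -⟩ := iso_zpow.exists_symm preserving_zpow
  have ergodic_zpow := hσ.ergodic hTn preserving_zpow.measurable
  exact ⟨continuous_perm_zpow h.continuous_map hT' n,
    h.isUniquelyErgodic.zpow hT'.measurable hn ergodic_zpow,
    h.continuous, semiconj_perm_zpow h.semiconj n, iso_zpow⟩

theorem exists_isUniqueInvariantLift {Y Y' : Type*} [TopologicalSpace Y] [MeasurableSpace Y]
    [TopologicalSpace Y'] [MeasurableSpace Y'] {T' : X' → X'} {T : X → X} {S' : Y' → Y'}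
    {ν' : Measure Y'} {S : Y → Y} {ν : Measure Y} {τ : Y' → Y}
    (hT : IsIsomorphicExtension T' μ' T μ π) (hS : IsIsomorphicExtension S' ν' S ν τ)
    {κ : Measure (X × Y)} [IsProbabilityMeasure κ] (hκ : IsCoupling μ ν κ)
    (hκTS : MeasurePreserving (Prod.map T S) κ κ) :
    ∃ ρ', IsUniqueInvariantLift (Prod.map T' S') (Prod.map π τ) κ ρ' := by
  have hT' := hT.isUniquelyErgodic.measurePreserving
  have hS' := hS.isUniquelyErgodic.measurePreserving
  have hπ := hT.isMeasureIso.measurePreserving.measurable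
  have hτ := hS.isMeasureIso.measurePreserving.measurable
  obtain ⟨f, hf, hfπ, hπf⟩ := hT.isMeasureIso.exists_symm hT'
  obtain ⟨g, hg, hgτ, hτg⟩ := hS.isMeasureIso.exists_symm hS'
  have hfm := hf.measurePreserving.measurable
  have hgm := hg.measurePreserving.measurable
  have hfg := hf.prodMap hg hκ
  refine ⟨κ.map (Prod.map f g),
    Measure.isProbabilityMeasure_map (hfm.prodMap hgm).aemeasurable,
    measurePreserving_of_ae_semiconj hκTS (hT'.measurable.prodMap hS'.measurable)
      hfg.measurePreserving hfg.equivariant,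
    hκ.map_prodMap_of_ae_leftInverse hfm hgm hπ hτ hπf hτg, fun ρ _ hρ hρκ => ?_⟩
  have hρ_coupling := hT.isUniquelyErgodic.isCoupling hS.isUniquelyErgodic hρ
  rw [← hρκ, hρ_coupling.map_prodMap_of_ae_leftInverse hπ hτ hfm hgm hfπ hgτ]

end IsIsomorphicExtension

end IsomorphicExtensions

section ContinuousModels

/-- The skew product of a continuous cocycle `ψ'` over an isomorphic extension `(X', T')` of
`(X, T)` is a continuous model of the ergodic system `Q` on `X × G`.  This notion, unlike the form
`Q = T_ψ`, makes no reference to a cocycle over `X`, and it is stable under taking powers. -/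
structure IsContinuousModel {X X' G : Type*} [TopologicalSpace X] [MeasurableSpace X]
    [TopologicalSpace X'] [MeasurableSpace X'] [TopologicalSpace G] [MeasurableSpace G] [Group G]
    (T' : Equiv.Perm X') (μ' : Measure X') (ψ' : X' → G) (T : X → X) (μ : Measure X)
    (Q : X × G → X × G) (η : Measure G) (π : X' → X) : Prop where
  base : IsIsomorphicExtension T' μ' T μ π
  continuous_cocycle : Continuous ψ'
  isMeasureIso : IsMeasureIso (μ'.prod η) (μ.prod η) (skewProduct T' ψ') Q (Prod.map π id)
  ergodic : Ergodic Q (μ.prod η)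

variable {X X' G : Type*} [TopologicalSpace X] [MeasurableSpace X]
  [TopologicalSpace X'] [MeasurableSpace X'] [BorelSpace X']
  [TopologicalSpace G] [SecondCountableTopology G] [MeasurableSpace G] [BorelSpace G] [Group G]
  [IsTopologicalGroup G] {T' : Equiv.Perm X'} {μ' : Measure X'} {ψ' : X' → G} {μ : Measure X}
  {η : Measure G} [IsProbabilityMeasure η] [η.IsMulLeftInvariant] {π : X' → X}

theorem IsContinuousModel.isUniquelyErgodic {T : X → X} {Q : X × G → X × G}
    (h : IsContinuousModel T' μ' ψ' T μ Q η π) :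
    IsUniquelyErgodic (skewProduct T' ψ') (μ'.prod η) := by
  have := h.base.isUniquelyErgodic.isProbabilityMeasure
  have preserving := measurePreserving_skewProduct (η := η)
    h.base.isUniquelyErgodic.measurePreserving h.continuous_cocycle.measurable
  obtain ⟨σ, hσ, -⟩ := h.isMeasureIso.exists_symm preserving
  exact h.base.isUniquelyErgodic.skewProduct (hσ.ergodic h.ergodic preserving.measurable)

theorem IsIsomorphicExtension.isContinuousModel_zpow [SFinite μ] {T : Equiv.Perm X} {ψ : X → G}
    (h : IsIsomorphicExtension T' μ' T μ π) (hT' : Continuous T'.symm) (hψ' : Continuous ψ')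
    (hψψ' : ψ' =ᵐ[μ'] ψ ∘ π) {n : ℤ} (hn : n ≠ 0) (hTn : Measurable ⇑(T ^ n))
    (hψn : Ergodic ⇑(skewProduct T ψ ^ n) (μ.prod η)) :
    IsContinuousModel (T' ^ n) μ' (skewCocycle T' ψ' n) ⇑(T ^ n) μ ⇑(skewProduct T ψ ^ n) η π where
  base := h.zpow hT' hn (ergodic_zpow_of_ergodic_skewProduct_zpow hTn hψn)
  continuous_cocycle := continuous_skewCocycle h.continuous_map hT' hψ' n
  isMeasureIso := by
    have := h.isUniquelyErgodic.isProbabilityMeasure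
    rw [← skewProduct_zpow]
    exact (h.isMeasureIso.skewProduct hψψ' η).zpow
      (measurePreserving_skewProduct h.isUniquelyErgodic.measurePreserving hψ'.measurable)
      (continuous_skewProduct_symm hT' hψ').measurable n
  ergodic := hψn

end ContinuousModels

namespace IsContinuousModel

variable {X₁ X₂ X₁' X₂' G₁ G₂ : Type*}
  [TopologicalSpace X₁] [PolishSpace X₁] [MeasurableSpace X₁] [BorelSpace X₁]
  [TopologicalSpace X₂] [PolishSpace X₂] [MeasurableSpace X₂] [BorelSpace X₂]
  [TopologicalSpace X₁'] [CompactSpace X₁'] [PolishSpace X₁'] [MeasurableSpace X₁'] [BorelSpace X₁']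
  [TopologicalSpace X₂'] [CompactSpace X₂'] [PolishSpace X₂'] [MeasurableSpace X₂'] [BorelSpace X₂']
  [Group G₁] [TopologicalSpace G₁] [IsTopologicalGroup G₁] [CompactSpace G₁] [PolishSpace G₁]
  [MeasurableSpace G₁] [BorelSpace G₁]
  [Group G₂] [TopologicalSpace G₂] [IsTopologicalGroup G₂] [CompactSpace G₂] [PolishSpace G₂]
  [MeasurableSpace G₂] [BorelSpace G₂]
  {T₁' : Equiv.Perm X₁'} {μ₁' : Measure X₁'} {ψ₁ : X₁' → G₁} {T₁ : X₁ → X₁} {μ₁ : Measure X₁}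
  {Q₁ : X₁ × G₁ → X₁ × G₁} {η₁ : Measure G₁} [IsProbabilityMeasure η₁] [η₁.IsMulLeftInvariant]
  {π₁ : X₁' → X₁}
  {T₂' : Equiv.Perm X₂'} {μ₂' : Measure X₂'} {ψ₂ : X₂' → G₂} {T₂ : X₂ → X₂} {μ₂ : Measure X₂}
  {Q₂ : X₂ × G₂ → X₂ × G₂} {η₂ : Measure G₂} [IsProbabilityMeasure η₂] [η₂.IsMulLeftInvariant]
  {π₂ : X₂' → X₂} {κ : Measure (X₁ × X₂)}

theorem exists_isErgodicJoining (h₁ : IsContinuousModel T₁' μ₁' ψ₁ T₁ μ₁ Q₁ η₁ π₁)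
    (h₂ : IsContinuousModel T₂' μ₂' ψ₂ T₂ μ₂ Q₂ η₂ π₂) [IsProbabilityMeasure κ]
    (hκ : IsCoupling μ₁ μ₂ κ) (hκerg : Ergodic (Prod.map T₁ T₂) κ) :
    ∃ ξ, IsErgodicJoining (μ₁.prod η₁) (μ₂.prod η₂) Q₁ Q₂ ξ ∧
      ξ.map (Prod.map Prod.fst Prod.fst) = κ := by
  have := h₁.base.isUniquelyErgodic.isProbabilityMeasure
  have := h₂.base.isUniquelyErgodic.isProbabilityMeasure
  have : Nonempty X₁' := nonempty_of_isProbabilityMeasure μ₁'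
  have : Nonempty X₂' := nonempty_of_isProbabilityMeasure μ₂'
  obtain ⟨ρ, hρ⟩ := h₁.base.exists_isUniqueInvariantLift h₂.base hκ hκerg.toMeasurePreserving
  have := hρ.isProbabilityMeasure
  have hρ_coupling := h₁.base.isUniquelyErgodic.isCoupling h₂.base.isUniquelyErgodic
    hρ.measurePreserving
  have := (isCoupling_relIndepExtension (η := η₁) (θ := η₂) hρ_coupling).isProbabilityMeasure
  have invariant := measurePreserving_relIndepExtension (η := η₁) (θ := η₂) hρ_coupling
    h₁.continuous_cocycle.measurable h₂.continuous_cocycle.measurable hρ.measurePreserving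
  have hπ : Continuous (Prod.map π₁ π₂) := h₁.base.continuous.prodMap h₂.base.continuous
  have hfst : Continuous (Prod.map (Prod.fst : X₁' × G₁ → X₁') (Prod.fst : X₂' × G₂ → X₂')) :=
    continuous_fst.prodMap continuous_fst
  obtain ⟨ξ, _, hξ, hξκ⟩ := exists_ergodic_lift (S' := Prod.map T₁ T₂)
    ((continuous_skewProduct h₁.base.continuous_map h₁.continuous_cocycle).prodMap
      (continuous_skewProduct h₂.base.continuous_map h₂.continuous_cocycle))
    (hπ.comp hfst)
    (fun q => Prod.ext (h₁.base.semiconj q.1.1) (h₂.base.semiconj q.2.1)) hκerg invariant (by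
      rw [← Measure.map_map hπ.measurable hfst.measurable,
        map_prodMap_fst_relIndepExtension hρ_coupling, hρ.map_eq])
  have hξ_coupling := h₁.isUniquelyErgodic.isCoupling h₂.isUniquelyErgodic hξ.toMeasurePreserving
  have iso := h₁.isMeasureIso.prodMap h₂.isMeasureIso hξ_coupling
  have coupling := hξ_coupling.map_prodMap h₁.isMeasureIso.measurePreserving
    h₂.isMeasureIso.measurePreserving
  refine ⟨_, ⟨coupling.map_fst, coupling.map_snd,
    iso.ergodic hξ (h₁.ergodic.measurable.prodMap h₂.ergodic.measurable)⟩, ?_⟩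
  rw [Measure.map_map (measurable_fst.prodMap measurable_fst) iso.measurePreserving.measurable,
    ← hξκ]
  rfl

variable [Nonempty X₁] [Nonempty X₂] [IsProbabilityMeasure μ₁] [IsProbabilityMeasure μ₂]

theorem exists_eq_graphJoining_and_ergodic (h₁ : IsContinuousModel T₁' μ₁' ψ₁ T₁ μ₁ Q₁ η₁ π₁)
    (h₂ : IsContinuousModel T₂' μ₂' ψ₂ T₂ μ₂ Q₂ η₂ π₂)
    (hjoin : ∀ ξ, IsErgodicJoining (μ₁.prod η₁) (μ₂.prod η₂) Q₁ Q₂ ξ →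
      ∃ R, IsMeasureIso μ₁ μ₂ T₁ T₂ R ∧
        ξ = relIndepExtension (μ₁.prod η₁) (μ₂.prod η₂) Prod.fst Prod.fst (graphJoining μ₁ R))
    (hκ : IsCoupling μ₁ μ₂ κ) (hκerg : Ergodic (Prod.map T₁ T₂) κ) :
    (∃ R, IsMeasureIso μ₁ μ₂ T₁ T₂ R ∧ κ = graphJoining μ₁ R) ∧
      Ergodic (Prod.map Q₁ Q₂)
        (relIndepExtension (μ₁.prod η₁) (μ₂.prod η₂) Prod.fst Prod.fst κ) := by
  have := hκ.isProbabilityMeasure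
  obtain ⟨ξ, hξ, rfl⟩ := h₁.exists_isErgodicJoining h₂ hκ hκerg
  obtain ⟨R, hR, hξR⟩ := hjoin ξ hξ
  have base_eq : ξ.map (Prod.map Prod.fst Prod.fst) = graphJoining μ₁ R := by
    rw [hξR, map_prodMap_fst_relIndepExtension (isCoupling_graphJoining hR.measurePreserving)]
  refine ⟨⟨R, hR, base_eq⟩, ?_⟩
  rw [base_eq, ← hξR]
  exact hξ.ergodic

theorem exists_isGenericLift [CompactSpace X₁] [CompactSpace X₂] [Nonempty X₁'] [Nonempty X₂']
    [IsProbabilityMeasure μ₁'] [IsProbabilityMeasure μ₂']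
    (h₁ : IsContinuousModel T₁' μ₁' ψ₁ T₁ μ₁ Q₁ η₁ π₁)
    (h₂ : IsContinuousModel T₂' μ₂' ψ₂ T₂ μ₂ Q₂ η₂ π₂) (hκ : IsCoupling μ₁ μ₂ κ)
    (hκT : MeasurePreserving (Prod.map T₁ T₂) κ κ)
    (herg : Ergodic (Prod.map Q₁ Q₂)
      (relIndepExtension (μ₁.prod η₁) (μ₂.prod η₂) Prod.fst Prod.fst κ))
    {x₁ : X₁'} {x₂ : X₂'} (hx : IsGeneric (Prod.map T₁ T₂) (π₁ x₁, π₂ x₂) κ) :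
    ∃ ρ, IsGenericLift (Prod.map T₁' T₂') (Prod.map π₁ π₂) (π₁ x₁, π₂ x₂) ρ ∧
      (∀ ρ', IsGenericLift (Prod.map T₁' T₂') (Prod.map π₁ π₂) (π₁ x₁, π₂ x₂) ρ' → ρ' = ρ) ∧
      (∀ g h, IsGeneric (Prod.map (skewProduct T₁' ψ₁) (skewProduct T₂' ψ₂)) ((x₁, g), (x₂, h))
        (relIndepExtension (μ₁'.prod η₁) (μ₂'.prod η₂) Prod.fst Prod.fst ρ)) ∧
      MeasureIsomorphic (relIndepExtension (μ₁'.prod η₁) (μ₂'.prod η₂) Prod.fst Prod.fst ρ)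
        (relIndepExtension (μ₁.prod η₁) (μ₂.prod η₂) Prod.fst Prod.fst κ)
        (Prod.map (skewProduct T₁' ψ₁) (skewProduct T₂' ψ₂)) (Prod.map Q₁ Q₂) := by
  have := hκ.isProbabilityMeasure
  obtain ⟨ρ, hρ⟩ := h₁.base.exists_isUniqueInvariantLift h₂.base hκ hκT
  have := hρ.isProbabilityMeasure
  have hρ_coupling := h₁.base.isUniquelyErgodic.isCoupling h₂.base.isUniquelyErgodic
    hρ.measurePreserving
  have iso := isMeasureIso_relIndepExtension h₁.base.isMeasureIso.measurePreserving
    h₂.base.isMeasureIso.measurePreserving hρ_coupling h₁.isMeasureIso h₂.isMeasureIso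
  rw [hρ.map_eq] at iso
  have invariant := measurePreserving_relIndepExtension (η := η₁) (θ := η₂) hρ_coupling
    h₁.continuous_cocycle.measurable h₂.continuous_cocycle.measurable hρ.measurePreserving
  obtain ⟨σ, hσ, -⟩ := iso.exists_symm invariant
  have unique_lift :=
    isUniqueInvariantLift_relIndepExtension hρ_coupling (hσ.ergodic herg invariant.measurable)
  have base_lift := hρ.isGenericLift (S' := Prod.map T₁ T₂)
    (h₁.base.continuous_map.prodMap h₂.base.continuous_map)
    (h₁.base.continuous.prodMap h₂.base.continuous)
    (fun q => Prod.ext (h₁.base.semiconj q.1) (h₂.base.semiconj q.2)) hx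
  have hskew := (continuous_skewProduct h₁.base.continuous_map h₁.continuous_cocycle).prodMap
    (continuous_skewProduct h₂.base.continuous_map h₂.continuous_cocycle)
  exact ⟨ρ, base_lift, fun ρ' hρ' => hρ'.unique (z := (x₁, x₂)) base_lift,
    fun g h => unique_lift.isGeneric hskew (continuous_fst.prodMap continuous_fst)
      (fun _ => rfl) (base_lift.isGeneric (x₁, x₂) rfl), _, iso⟩

end IsContinuousModel

section Odometers

theorem odometerScale_ne_zero {lam : ℕ → ℕ} (hlam : ∀ t, 2 ≤ lam t) (t : ℕ) :
    odometerScale lam t ≠ 0 :=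
  Finset.prod_ne_zero_iff.2 fun i _ => by have := hlam i; omega

namespace Odometer

variable {lam : ℕ → ℕ}

instance : IsTopologicalRing (Odometer lam) :=
  inferInstanceAs (IsTopologicalRing (odometerSubring lam))

theorem compactSpace (hlam : ∀ t, 2 ≤ lam t) : CompactSpace (Odometer lam) := by
  have (t : ℕ) : NeZero (odometerScale lam t) := ⟨odometerScale_ne_zero hlam t⟩
  have closed : IsClosed {x : ∀ t, ZMod (odometerScale lam t) | ∀ t,
      ZMod.castHom (odometerScale_dvd_succ lam t) (ZMod (odometerScale lam t)) (x (t + 1)) =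
        x t} := by
    simp only [Set.ofPred_forall]
    exact isClosed_iInter fun t => isClosed_eq
      (continuous_of_discreteTopology.comp (continuous_apply (t + 1))) (continuous_apply t)
  exact isCompact_iff_compactSpace.1 closed.isCompact

theorem not_ergodic_id (hlam : ∀ t, 2 ≤ lam t) (mX : Measure (Odometer lam))
    [mX.IsOpenPosMeasure] : ¬ Ergodic id mX := by
  intro herg
  let digit (x : Odometer lam) : ZMod (odometerScale lam 1) := x.1 1
  have digit_continuous : Continuous digit := (continuous_apply 1).comp continuous_subtype_val
  have : Fact (1 < odometerScale lam 1) := ⟨by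
    have := hlam 0
    rw [odometerScale, Finset.prod_range_one]
    omega⟩
  have clopen : IsClopen (digit ⁻¹' {0}) := (isClopen_discrete {0}).preimage digit_continuous
  have zero_mem : (0 : Odometer lam) ∈ digit ⁻¹' {0} := rfl
  have one_mem : (1 : Odometer lam) ∈ (digit ⁻¹' {0})ᶜ :=
    one_ne_zero (α := ZMod (odometerScale lam 1))
  rcases herg.ae_empty_or_univ clopen.isOpen.measurableSet rfl with h | h
  · exact clopen.isOpen.measure_ne_zero mX ⟨0, zero_mem⟩ (ae_eq_empty.1 h)
  · exact clopen.compl.isOpen.measure_ne_zero mX ⟨1, one_mem⟩ (ae_eq_univ.1 h)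

end Odometer

end Odometers

theorem mainTheorem9_general {X : Type*} [AddCommGroup X] [TopologicalSpace X]
    [IsTopologicalAddGroup X] [CompactSpace X] [PolishSpace X] [MeasurableSpace X] [BorelSpace X]
    (mX : Measure X) [mX.IsAddLeftInvariant] [IsProbabilityMeasure mX] (a : X)
    {G : Type*} [Group G] [TopologicalSpace G] [IsTopologicalGroup G] [CompactSpace G]
    [PolishSpace G] [MeasurableSpace G] [BorelSpace G]
    (mG : Measure G) [mG.IsMulLeftInvariant] [IsProbabilityMeasure mG]
    {X' : Type*} [TopologicalSpace X'] [CompactSpace X'] [PolishSpace X'] [Nonempty X']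
    [MeasurableSpace X'] [BorelSpace X'] (T' : X' ≃ₜ X') (mX' : Measure X')
    [IsProbabilityMeasure mX'] (hT' : IsUniquelyErgodic T' mX') (π : X' → X) (hπ : Continuous π)
    (hπT' : Function.Semiconj π T' (Equiv.addRight a))
    (hiso : MeasureIsomorphic mX mX' (Equiv.addRight a) T')
    (ψ : X → G) (ψ' : X' → G) (hψ' : Continuous ψ') (hψψ' : ψ' =ᵐ[mX'] ψ ∘ π)
    {r s : ℤ} (hr₀ : r ≠ 0) (hs₀ : s ≠ 0)
    (hr : Ergodic ⇑(skewProduct (Equiv.addRight a) ψ ^ r) (mX.prod mG))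
    (hs : Ergodic ⇑(skewProduct (Equiv.addRight a) ψ ^ s) (mX.prod mG))
    (hjoin : ∀ κ : Measure ((X × G) × (X × G)),
      IsErgodicJoining (mX.prod mG) (mX.prod mG) ⇑(skewProduct (Equiv.addRight a) ψ ^ r)
        ⇑(skewProduct (Equiv.addRight a) ψ ^ s) κ →
      ∃ R : X → X, IsMeasureIso mX mX ⇑(Equiv.addRight a ^ r) ⇑(Equiv.addRight a ^ s) R ∧
        κ = relIndepExtension (mX.prod mG) (mX.prod mG) Prod.fst Prod.fst (graphJoining mX R))
    (x y : X') :
    (∃ R : X → X, IsMeasureIso mX mX ⇑(Equiv.addRight a ^ r) ⇑(Equiv.addRight a ^ s) R ∧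
      IsGeneric (Prod.map ⇑(Equiv.addRight a ^ r) ⇑(Equiv.addRight a ^ s)) (π x, π y)
        (graphJoining mX R)) ∧
    ∀ R : X → X, IsMeasureIso mX mX ⇑(Equiv.addRight a ^ r) ⇑(Equiv.addRight a ^ s) R →
      IsGeneric (Prod.map ⇑(Equiv.addRight a ^ r) ⇑(Equiv.addRight a ^ s)) (π x, π y)
        (graphJoining mX R) →
      ∃ ρ' : Measure (X' × X'),
        IsGenericLift (Prod.map ⇑(T'.toEquiv ^ r) ⇑(T'.toEquiv ^ s)) (Prod.map π π)
          (π x, π y) ρ' ∧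
        (∀ ρ'' : Measure (X' × X'),
          IsGenericLift (Prod.map ⇑(T'.toEquiv ^ r) ⇑(T'.toEquiv ^ s)) (Prod.map π π)
            (π x, π y) ρ'' → ρ'' = ρ') ∧
        (∀ g h : G,
          IsGeneric
            (Prod.map ⇑(skewProduct T'.toEquiv ψ' ^ r) ⇑(skewProduct T'.toEquiv ψ' ^ s))
            ((x, g), (y, h))
            (relIndepExtension (mX'.prod mG) (mX'.prod mG) Prod.fst Prod.fst ρ')) ∧
        MeasureIsomorphic
          (relIndepExtension (mX'.prod mG) (mX'.prod mG) Prod.fst Prod.fst ρ')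
          (relIndepExtension (mX.prod mG) (mX.prod mG) Prod.fst Prod.fst (graphJoining mX R))
          (Prod.map ⇑(skewProduct T'.toEquiv ψ' ^ r) ⇑(skewProduct T'.toEquiv ψ' ^ s))
          (Prod.map ⇑(skewProduct (Equiv.addRight a) ψ ^ r)
            ⇑(skewProduct (Equiv.addRight a) ψ ^ s)) := by
  have zpow_eq (n : ℤ) : ⇑(Equiv.addRight a ^ n) = Equiv.addRight (n • a) :=
    congrArg _ (addRight_zpow a n)
  have zpow_measurable (n : ℤ) : Measurable ⇑(Equiv.addRight a ^ n) :=
    zpow_eq n ▸ measurable_add_const (n • a)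
  have hTr := ergodic_zpow_of_ergodic_skewProduct_zpow (zpow_measurable r) hr
  have hTs := ergodic_zpow_of_ergodic_skewProduct_zpow (zpow_measurable s) hs
  have hT := ergodic_of_ergodic_zpow (T := Equiv.addRight a) (measurePreserving_add_right mX a) hTr
  have extension : IsIsomorphicExtension T'.toEquiv mX' (Equiv.addRight a) mX π :=
    ⟨T'.continuous, hT', hπ, hπT', isMeasureIso_of_semiconj_addRight hT hπ.measurable hπT' hiso⟩
  have model_r := extension.isContinuousModel_zpow T'.symm.continuous hψ' hψψ' hr₀
    hTr.measurable hr
  have model_s := extension.isContinuousModel_zpow T'.symm.continuous hψ' hψψ' hs₀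
    hTs.measurable hs
  constructor
  · obtain ⟨κ, hκ, hκerg, generic⟩ :=
      exists_isGeneric_coupling_addRight (zpow_eq r) (zpow_eq s) hTr hTs (π x) (π y)
    obtain ⟨⟨R, hR, rfl⟩, -⟩ := model_r.exists_eq_graphJoining_and_ergodic model_s hjoin hκ hκerg
    exact ⟨R, hR, generic⟩
  · intro R hR generic
    have hκ := isCoupling_graphJoining hR.measurePreserving
    have hκerg := ergodic_graphJoining hTr hTs.measurable hR
    obtain ⟨-, herg⟩ := model_r.exists_eq_graphJoining_and_ergodic model_s hjoin hκ hκerg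
    simp only [skewProduct_zpow T'.toEquiv]
    exact model_r.exists_isGenericLift model_s hκ hκerg.toMeasurePreserving herg generic

theorem mainTheorem9
    -- the odometer `(X, T, m_X)`
    (lam : ℕ → ℕ) (hlam : ∀ t, 2 ≤ lam t)
    (mX : Measure (Odometer lam)) [mX.IsAddHaarMeasure] [IsProbabilityMeasure mX]
    -- the compact metric group `G`
    {G : Type*} [Group G] [MetricSpace G] [CompactSpace G] [IsTopologicalGroup G]
    [MeasurableSpace G] [BorelSpace G]
    (mG : Measure G) [mG.IsHaarMeasure] [IsProbabilityMeasure mG]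
    -- the uniquely ergodic extension `(X', T', mX')` of the odometer
    {X' : Type*} [MetricSpace X'] [CompactSpace X'] [Nonempty X']
    [MeasurableSpace X'] [BorelSpace X']
    (T' : X' ≃ₜ X') (mX' : Measure X') [IsProbabilityMeasure mX']
    (hT' : IsUniquelyErgodic T' mX')
    (π : X' → Odometer lam) (hπ : IsTopologicalFactor T' (Odometer.shift lam) π)
    (hiso : MeasureIsomorphic mX mX' (Odometer.shift lam) T')
    -- the ergodic cocycle
    (ψ : Odometer lam → G) (hψ : Measurable ψ)
    (hψerg : Ergodic (skewProduct (Odometer.shift lam) ψ) (mX.prod mG))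
    -- its continuous version on `X'`
    (ψ' : X' → G) (hψ' : Continuous ψ') (hψψ' : ψ' =ᵐ[mX'] ψ ∘ π)
    -- the powers
    (r s : ℤ) (hrs : r ≠ s)
    (hr : Ergodic ⇑(skewProduct (Odometer.shift lam) ψ ^ r) (mX.prod mG))
    (hs : Ergodic ⇑(skewProduct (Odometer.shift lam) ψ ^ s) (mX.prod mG))
    -- the only ergodic joinings are the relatively independent extensions
    (hjoin : ∀ κ : Measure ((Odometer lam × G) × (Odometer lam × G)),
      IsErgodicJoining (mX.prod mG) (mX.prod mG)
        ⇑(skewProduct (Odometer.shift lam) ψ ^ r) ⇑(skewProduct (Odometer.shift lam) ψ ^ s) κ →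
      ∃ R : Odometer lam → Odometer lam,
        IsMeasureIso mX mX ⇑(Odometer.shift lam ^ r) ⇑(Odometer.shift lam ^ s) R ∧
        κ = relIndepExtension (mX.prod mG) (mX.prod mG) Prod.fst Prod.fst (graphJoining mX R))
    (x' : X') :
    (∃ R : Odometer lam → Odometer lam,
      IsMeasureIso mX mX ⇑(Odometer.shift lam ^ r) ⇑(Odometer.shift lam ^ s) R ∧
      IsGeneric (Prod.map ⇑(Odometer.shift lam ^ r) ⇑(Odometer.shift lam ^ s)) (π x', π x')
        (graphJoining mX R)) ∧
    ∀ R : Odometer lam → Odometer lam,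
      IsMeasureIso mX mX ⇑(Odometer.shift lam ^ r) ⇑(Odometer.shift lam ^ s) R →
      IsGeneric (Prod.map ⇑(Odometer.shift lam ^ r) ⇑(Odometer.shift lam ^ s)) (π x', π x')
        (graphJoining mX R) →
      ∃ ρ' : Measure (X' × X'),
        -- `ρ'` is the unique invariant measure for which all points over `(π x', π x')` are generic
        IsGenericLift (Prod.map ⇑(T'.toEquiv ^ r) ⇑(T'.toEquiv ^ s)) (Prod.map π π)
          (π x', π x') ρ' ∧
        (∀ ρ'' : Measure (X' × X'),
          IsGenericLift (Prod.map ⇑(T'.toEquiv ^ r) ⇑(T'.toEquiv ^ s)) (Prod.map π π)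
            (π x', π x') ρ'' → ρ'' = ρ') ∧
        (∀ g : G,
          IsGeneric
            (Prod.map ⇑(skewProduct T'.toEquiv ψ' ^ r)
              ⇑(skewProduct T'.toEquiv ψ' ^ s))
            ((x', g), (x', g))
            (relIndepExtension (mX'.prod mG) (mX'.prod mG) Prod.fst Prod.fst ρ')) ∧
        MeasureIsomorphic
          (relIndepExtension (mX'.prod mG) (mX'.prod mG) Prod.fst Prod.fst ρ')
          (relIndepExtension (mX.prod mG) (mX.prod mG) Prod.fst Prod.fst (graphJoining mX R))
          (Prod.map ⇑(skewProduct T'.toEquiv ψ' ^ r)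
            ⇑(skewProduct T'.toEquiv ψ' ^ s))
          (Prod.map ⇑(skewProduct (Odometer.shift lam) ψ ^ r)
            ⇑(skewProduct (Odometer.shift lam) ψ ^ s)) := by
  have := Odometer.compactSpace hlam
  have ne_zero {n : ℤ} (hn : Ergodic ⇑(skewProduct (Odometer.shift lam) ψ ^ n) (mX.prod mG)) :
      n ≠ 0 := by
    rintro rfl
    exact Odometer.not_ergodic_id hlam mX
      (ergodic_zpow_of_ergodic_skewProduct_zpow measurable_id hn)
  obtain ⟨generic, lift⟩ := mainTheorem9_general mX 1 mG T' mX' hT' π hπ.continuous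
    (congrFun hπ.equivariant) hiso ψ ψ' hψ' hψψ' (ne_zero hr) (ne_zero hs) hr hs hjoin x' x'
  refine ⟨generic, fun R hR hRx => ?_⟩
  obtain ⟨ρ', generic_lift, unique, generic_point, iso⟩ := lift R hR hRx
  exact ⟨ρ', generic_lift, unique, fun g => generic_point g g, iso⟩
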